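/- Let $m_1,m_2\ge 1$. For real $m_1\times m_2$ matrices let $\langle A,B\rangle=\mathrm{tr}(A^\top B)$, let $\|\cdot\|_F$ be the Frobenius norm, $\|\cdot\|_1$ the entrywise $\ell_1$ norm and $\|\cdot\|_*$ the trace norm (the sum of the singular values). For a norm $\Omega$ let $\Omega^*(X)=\sup\{\langle X,Z\rangle:\Omega(Z)\le 1\}$ be its dual norm, and let $\sigma>0$. (i) For every norm $\Omega$ on $\mathbb R^{m_1\times m_2}$, all $Z^\star,G\in\mathbb R^{m_1\times m_2}$, every $\lambda\ge\sigma\Omega^*(G)$, and every $\hat Z\in\arg\min_Z \frac12\|Z-(Z^\star+\sigma G)\|_F^2+\lambda\Omega(Z)$, one has $\|\hat Z-Z^\star\|_F^2\le 4\lambda\,\Omega(Z^\star)$. (ii) Let $1\le k\le m_1$ and $1\le q\le m_2$, and let $\mathcal A_{k,q}$ be the set of matrices $ab^\top$ with $a\in\mathbb R^{m_1}$, $b\in\mathbb R^{m_2}$ of Euclidean norm $1$ having at most $k$, respectively $q$, nonzero coordinates. Let $\Omega_{k,q}(Z)=\inf\{t>0: Z\in t\,\mathrm{conv}(\mathcal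 A_{k,q})\}$ be the $(k,q)$-trace norm. Let $Z^\star\in\mathcal A_{k,q}$ and let $G$ be a random $m_1\times m_2$ matrix with i.i.d. $\mathcal N(0,1)$ entries. For a norm $\Omega$, let the oracle denoiser $\hat Z^{\mathrm{Oracle}}_\Omega$ be the minimizer over $Z$ of $\frac12\|Z-(Z^\star+\sigma G)\|_F^2+\lambda\Omega(Z)$ for $\lambda=\sigma\Omega^*(G)$; write $\hat Z^{\mathrm{Oracle}}_1$ and $\hat Z^{\mathrm{Oracle}}_*$ for it when $\Omega$ is $\|\cdot\|_1$ and $\|\cdot\|_*$ respectively. Then the squared errors below are integrable, and $$\mathbb E\,\|\hat Z^{\mathrm{Oracle}}_{\Omega_{k,q}}-Z^\star\|_F^2\le 8\sigma\Big(\sqrt{k\log\tfrac{m_1}{k}+2k}+\sqrt{q\log\tfrac{m_2}{q}+2q}\Big),$$ $$\mathbb E\,\|\hat Z^{\mathrm{Oracle}}_1-Z^\star\|_F^2\le 2\sigma\|Z^\star\|_1\sqrt{2\log(m_1m_2)}\le 2\sigma\sqrt{2kq\log(m_1m_2)}\quad\text{provided } m_1m_2\ge 2,$$ $$\mathbb E\,\|\hat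 Z^{\mathrm{Oracle}}_*-Z^\star\|_F^2\le 2\sigma(\sqrt{m_1}+\sqrt{m_2}).$$ -/

import Mathlib

noncomputable section

/-- The standard inner product `⟨A, B⟩ = tr (Aᵀ B)` of real matrices. -/
def matInner {m₁ m₂ : ℕ} (A B : Matrix (Fin m₁) (Fin m₂) ℝ) : ℝ :=
  (A.transpose * B).trace

/-- The squared Frobenius norm `‖Z‖_F²`. -/
def frobSq {m₁ m₂ : ℕ} (Z : Matrix (Fin m₁) (Fin m₂) ℝ) : ℝ :=
  ∑ i, ∑ j, Z i j ^ 2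

/-- The entrywise `ℓ₁` norm `‖Z‖₁`. -/
def l1Norm {m₁ m₂ : ℕ} (Z : Matrix (Fin m₁) (Fin m₂) ℝ) : ℝ :=
  ∑ i, ∑ j, |Z i j|

/-- The trace (nuclear) norm `‖Z‖_*`: the sum of the singular values of `Z`, seen as a linear map
`ℝ^m₂ → ℝ^m₁` between Euclidean spaces (its singular values of index `≥ m₂` vanish). -/
def traceNorm {m₁ m₂ : ℕ} (Z : Matrix (Fin m₁) (Fin m₂) ℝ) : ℝ :=
  ∑ i ∈ Finset.range m₂, (Matrix.toEuclideanLin Z).singularValues i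

/-- `𝒜ⁿ_j`: the Euclidean unit vectors of `ℝⁿ` with at most `j` nonzero coordinates. -/
def sparseUnit (n j : ℕ) : Set (EuclideanSpace ℝ (Fin n)) :=
  {a | {i | a i ≠ 0}.ncard ≤ j ∧ ‖a‖ = 1}

/-- `𝒜_{k,q}`: the matrices `a bᵀ` with `a ∈ 𝒜^{m₁}_k` and `b ∈ 𝒜^{m₂}_q`. -/
def kqAtoms (m₁ m₂ k q : ℕ) : Set (Matrix (Fin m₁) (Fin m₂) ℝ) :=
  {A | ∃ a ∈ sparseUnit m₁ k, ∃ b ∈ sparseUnit m₂ q,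
    A = Matrix.of fun i j => a i * b j}

/-- The `(k,q)`-trace norm `Ω_{k,q}`: the atomic norm induced by `𝒜_{k,q}`, that is
`Z ↦ inf {t > 0 : Z ∈ t conv 𝒜_{k,q}}`. -/
def kqTraceNorm {m₁ m₂ : ℕ} (k q : ℕ) (Z : Matrix (Fin m₁) (Fin m₂) ℝ) : ℝ :=
  gauge (convexHull ℝ (kqAtoms m₁ m₂ k q)) Z

/-- The dual norm `Ω*(X) = sup {⟨X, Z⟩ : Ω(Z) ≤ 1}`. -/
def dualNorm {m₁ m₂ : ℕ} (Ω : Matrix (Fin m₁) (Fin m₂) ℝ → ℝ)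
    (X : Matrix (Fin m₁) (Fin m₂) ℝ) : ℝ :=
  sSup {r | ∃ Z, Ω Z ≤ 1 ∧ r = matInner X Z}

/-- `Z` is a penalized least-squares denoiser of `Y`:
`Z ∈ argmin_W ½ ‖W - Y‖_F² + lam Ω(W)`. -/
def IsDenoiser {m₁ m₂ : ℕ} (Ω : Matrix (Fin m₁) (Fin m₂) ℝ → ℝ) (lam : ℝ)
    (Y Z : Matrix (Fin m₁) (Fin m₂) ℝ) : Prop :=
  ∀ W : Matrix (Fin m₁) (Fin m₂) ℝ,
    1 / 2 * frobSq (Z - Y) + lam * Ω Z ≤ 1 / 2 * frobSq (W - Y) + lam * Ω W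

/-- `Z` is the oracle denoiser of `Y = Zstar + σ G`: the penalized least-squares denoiser with
regularization parameter `σ Ω*(G)`. -/
def IsOracleDenoiser {m₁ m₂ : ℕ} (Ω : Matrix (Fin m₁) (Fin m₂) ℝ → ℝ) (σ : ℝ)
    (Zstar G Z : Matrix (Fin m₁) (Fin m₂) ℝ) : Prop :=
  IsDenoiser Ω (σ * dualNorm Ω G) (Zstar + σ • G) Z

/-- `G` is a random matrix with i.i.d. standard normal entries. -/
def IsStdGaussianMatrix {S : Type*} [MeasurableSpace S] {m₁ m₂ : ℕ}
    (G : S → Matrix (Fin m₁) (Fin m₂) ℝ) (P : MeasureTheory.Measure S) : Prop :=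
  (∀ i j, ProbabilityTheory.HasLaw (fun s => G s i j) (ProbabilityTheory.gaussianReal 0 1) P) ∧
  ProbabilityTheory.iIndepFun (fun (p : Fin m₁ × Fin m₂) s => G s p.1 p.2) P

end

/-!
The optimality condition of a denoiser `Z` of `Y = Zstar + σ G`, tested in the direction of `Zstar`,
reads `⟨Y - Z, Zstar - Z⟩ ≤ lam (Ω Zstar - Ω Z)` (`IsDenoiser.matInner_le`). When
`σ Ω*(G) ≤ lam`, duality makes the terms in `Ω Z` cancel and leaves
`‖Z - Zstar‖² ≤ lam Ω(Zstar) - σ ⟨G, Zstar⟩` (`IsDenoiser.frobSq_sub_le`). This gives the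
deterministic inequality. For the oracle choice of `lam` the last term is centred, so that
`E ‖Z - Zstar‖² ≤ σ Ω(Zstar) E Ω*(G)` (`IsStdGaussianMatrix.oracle_error_le`). The error is a
measurable function because the oracle denoiser depends on the noise in a Lipschitz way
(`exists_l1Norm_sub_le_of_isOracleDenoiser`).

It remains to bound `E Ω*(G)`. For the `(k,q)`-trace norm, `Ω*(G)` is at most the supremum of
`uᵀ G v` over sparse unit vectors. For a pair of supports `I`, `J` of sizes `k`, `q`, the weight
`exp (lam xᵀ G y - lam² |x|² |y|² / 2)` has mean one for fixed `x`, `y`; it is averaged over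
independent centred Gaussian vectors `x` on `I` and `y` on `J` with variances `1 / k` and `1 / q`. By the
Cameron–Martin formula `(x, y)` may be recentred at `(u, v)`, at the price `(k + q) / 2` in the
exponent, and the exponent then has mean `lam uᵀ G v - 2 lam² - (k + q) / 2`
(`integral_shifted_exponent`). Bounding the exponential below by its tangent line at `log N`, where
`N` is the number of pairs of supports, dominates all values `uᵀ G v` at once by an affine function
of the total weight, whose mean is `N`. Optimizing in `lam` yields
`E sup uᵀ G v ≤ 2 √(k + q + 2 log N)` (`IsStdGaussianMatrix.exists_integrable_bound_kqAtoms`).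

The trace norm is the `(m₁,m₂)`-trace norm (`traceNorm_eq_kqTraceNorm`), for which `N = 1`. For the
entrywise `ℓ₁` norm, `Ω*(G)` is at most the largest absolute value of an entry of `G`, and the same
tangent-line argument bounds its mean by `√(2 log (2 m₁ m₂)) ≤ 2 √(2 log (m₁ m₂))`.
-/

section

open MeasureTheory ProbabilityTheory Finset

/-! ### The inner product, norms and deterministic error bounds -/

section Deterministic

variable {m₁ m₂ : ℕ}

lemma matInner_eq_sum (A B : Matrix (Fin m₁) (Fin m₂) ℝ) :
    matInner A B = ∑ i, ∑ j, A i j * B i j := by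
  simp only [matInner, Matrix.trace, Matrix.diag, Matrix.mul_apply, Matrix.transpose_apply]
  exact Finset.sum_comm

lemma matInner_comm (A B : Matrix (Fin m₁) (Fin m₂) ℝ) : matInner A B = matInner B A := by
  simp only [matInner_eq_sum, mul_comm]

lemma matInner_add_right (A B C : Matrix (Fin m₁) (Fin m₂) ℝ) :
    matInner A (B + C) = matInner A B + matInner A C := by
  simp [matInner_eq_sum, mul_add, Finset.sum_add_distrib]

lemma matInner_smul_right (A B : Matrix (Fin m₁) (Fin m₂) ℝ) (c : ℝ) :
    matInner A (c • B) = c * matInner A B := by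
  simp [matInner_eq_sum, Finset.mul_sum, mul_left_comm]

/-- The linear functional `⟨A, ·⟩`. -/
def matInnerₗ (A : Matrix (Fin m₁) (Fin m₂) ℝ) : Matrix (Fin m₁) (Fin m₂) ℝ →ₗ[ℝ] ℝ where
  toFun := matInner A
  map_add' := matInner_add_right A
  map_smul' c B := matInner_smul_right A B c

lemma matInner_sub_right (A B C : Matrix (Fin m₁) (Fin m₂) ℝ) :
    matInner A (B - C) = matInner A B - matInner A C :=
  map_sub (matInnerₗ A) B C

lemma matInner_neg_right (A B : Matrix (Fin m₁) (Fin m₂) ℝ) :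
    matInner A (-B) = -matInner A B :=
  map_neg (matInnerₗ A) B

lemma matInner_zero_right (A : Matrix (Fin m₁) (Fin m₂) ℝ) : matInner A 0 = 0 :=
  map_zero (matInnerₗ A)

lemma matInner_add_left (A B C : Matrix (Fin m₁) (Fin m₂) ℝ) :
    matInner (A + B) C = matInner A C + matInner B C := by
  simp only [matInner_comm _ C, matInner_add_right]

lemma matInner_sub_left (A B C : Matrix (Fin m₁) (Fin m₂) ℝ) :
    matInner (A - B) C = matInner A C - matInner B C := by
  simp only [matInner_comm _ C, matInner_sub_right]

lemma matInner_smul_left (A B : Matrix (Fin m₁) (Fin m₂) ℝ) (c : ℝ) :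
    matInner (c • A) B = c * matInner A B := by
  simp only [matInner_comm _ B, matInner_smul_right]

lemma frobSq_eq_matInner (Z : Matrix (Fin m₁) (Fin m₂) ℝ) : frobSq Z = matInner Z Z := by
  simp only [frobSq, matInner_eq_sum, sq]

lemma frobSq_nonneg (Z : Matrix (Fin m₁) (Fin m₂) ℝ) : 0 ≤ frobSq Z :=
  Finset.sum_nonneg fun _ _ => Finset.sum_nonneg fun _ _ => sq_nonneg _

lemma abs_le_l1Norm (Z : Matrix (Fin m₁) (Fin m₂) ℝ) (i : Fin m₁) (j : Fin m₂) :
    |Z i j| ≤ l1Norm Z :=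
  (Finset.single_le_sum (f := fun j => |Z i j|) (fun _ _ => abs_nonneg _) (mem_univ j)).trans
    (Finset.single_le_sum (f := fun i => ∑ j, |Z i j|)
      (fun _ _ => Finset.sum_nonneg fun _ _ => abs_nonneg _) (mem_univ i))

lemma l1Norm_nonneg (Z : Matrix (Fin m₁) (Fin m₂) ℝ) : 0 ≤ l1Norm Z :=
  Finset.sum_nonneg fun _ _ => Finset.sum_nonneg fun _ _ => abs_nonneg _

lemma matInner_le_mul_l1Norm {G Z : Matrix (Fin m₁) (Fin m₂) ℝ} {M : ℝ}
    (h : ∀ i j, |G i j| ≤ M) : matInner G Z ≤ M * l1Norm Z := by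
  rw [matInner_eq_sum, l1Norm, Finset.mul_sum]
  refine Finset.sum_le_sum fun i _ => ?_
  rw [Finset.mul_sum]
  refine Finset.sum_le_sum fun j _ => (le_abs_self _).trans ?_
  rw [abs_mul]
  exact mul_le_mul_of_nonneg_right (h i j) (abs_nonneg _)

/-- Cauchy–Schwarz between the entrywise `ℓ₁` norm and the Frobenius norm. -/
lemma sq_l1Norm_le (Z : Matrix (Fin m₁) (Fin m₂) ℝ) :
    l1Norm Z ^ 2 ≤ (m₁ * m₂ : ℝ) * frobSq Z := by
  have h := sq_sum_le_card_mul_sum_sq (s := (univ : Finset (Fin m₁ × Fin m₂)))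
    (f := fun p => |Z p.1 p.2|)
  simp only [sq_abs, Fintype.sum_prod_type, card_univ, Fintype.card_prod, Fintype.card_fin] at h
  simpa [l1Norm, frobSq] using h

/-- The entrywise `ℓ₁` norm as a seminorm. -/
noncomputable def l1Seminorm (m₁ m₂ : ℕ) : Seminorm ℝ (Matrix (Fin m₁) (Fin m₂) ℝ) :=
  Seminorm.of l1Norm
    (fun A B => by
      simp only [l1Norm, ← Finset.sum_add_distrib]
      exact Finset.sum_le_sum fun i _ => Finset.sum_le_sum fun j _ => abs_add_le _ _)
    (fun c A => by simp [l1Norm, Finset.mul_sum, abs_mul])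

/-- Every seminorm on matrices is dominated by the entrywise `ℓ₁` norm. -/
lemma Seminorm.exists_le_mul_l1Norm (p : Seminorm ℝ (Matrix (Fin m₁) (Fin m₂) ℝ)) :
    ∃ C, 0 ≤ C ∧ ∀ Z, p Z ≤ C * l1Norm Z := by
  refine ⟨∑ i, ∑ j, p (Matrix.single i j 1), Finset.sum_nonneg fun _ _ =>
    Finset.sum_nonneg fun _ _ => apply_nonneg _ _, fun Z => ?_⟩
  have hsum : ∀ {ι : Type} (s : Finset ι) (f : ι → Matrix (Fin m₁) (Fin m₂) ℝ),
      p (∑ i ∈ s, f i) ≤ ∑ i ∈ s, p (f i) := fun s f =>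
    Finset.le_sum_of_subadditive p (map_zero p).le (map_add_le_add p) s f
  conv_lhs => rw [Matrix.matrix_eq_sum_single Z]
  rw [Finset.sum_mul]
  refine (hsum _ _).trans (Finset.sum_le_sum fun i _ => ?_)
  rw [Finset.sum_mul]
  refine (hsum _ _).trans (Finset.sum_le_sum fun j _ => ?_)
  have : Matrix.single i j (Z i j) = Z i j • Matrix.single i j (1 : ℝ) := by
    rw [Matrix.smul_single]; simp
  rw [this, map_smul_eq_mul, Real.norm_eq_abs, mul_comm]
  exact mul_le_mul_of_nonneg_left (abs_le_l1Norm Z i j) (apply_nonneg _ _)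

/-- On a finite-dimensional space a linear functional is bounded with respect to any norm. -/
lemma Seminorm.exists_linearMap_le_mul {E : Type*} [AddCommGroup E] [Module ℝ E]
    [FiniteDimensional ℝ E] (p : Seminorm ℝ E) (hp : ∀ x, p x = 0 → x = 0) (f : E →ₗ[ℝ] ℝ) :
    ∃ C, ∀ x, f x ≤ C * p x := by
  let q : AddGroupNorm E :=
    { p.toAddGroupSeminorm with eq_zero_of_map_eq_zero' := hp }
  let _ : NormedAddCommGroup E := q.toNormedAddCommGroup
  let _ : NormedSpace ℝ E := ⟨fun c x => (map_smul_eq_mul p c x).le⟩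
  refine ⟨‖LinearMap.toContinuousLinearMap f‖, fun x => ?_⟩
  exact (le_abs_self _).trans ((LinearMap.toContinuousLinearMap f).le_opNorm x)

/-- Every linear functional is bounded on the unit ball of the seminorm `Ω`, so that the supremum
defining the dual norm is a genuine one. -/
def DominatesFunctionals (Ω : Seminorm ℝ (Matrix (Fin m₁) (Fin m₂) ℝ)) : Prop :=
  ∀ X, ∃ C, ∀ Z, matInner X Z ≤ C * Ω Z

lemma dominatesFunctionals_of_definite {Ω : Seminorm ℝ (Matrix (Fin m₁) (Fin m₂) ℝ)}
    (hΩ : ∀ Z, Ω Z = 0 → Z = 0) : DominatesFunctionals Ω :=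
  fun X => Ω.exists_linearMap_le_mul hΩ (matInnerₗ X)

lemma dominatesFunctionals_l1Seminorm : DominatesFunctionals (l1Seminorm m₁ m₂) :=
  fun X => ⟨l1Norm X, fun _ => matInner_le_mul_l1Norm (abs_le_l1Norm X)⟩

section Dual

variable {Ω : Seminorm ℝ (Matrix (Fin m₁) (Fin m₂) ℝ)}

lemma dualNorm_le {X : Matrix (Fin m₁) (Fin m₂) ℝ} {M : ℝ} (hM : 0 ≤ M)
    (h : ∀ Z, matInner X Z ≤ M * Ω Z) : dualNorm Ω X ≤ M := by
  refine csSup_le ⟨0, 0, by simp, by simp [matInner_zero_right]⟩ ?_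
  rintro r ⟨Z, hZ, rfl⟩
  exact (h Z).trans (mul_le_of_le_one_right hM hZ)

lemma matInner_le_dualNorm (hΩ : DominatesFunctionals Ω) (X : Matrix (Fin m₁) (Fin m₂) ℝ)
    {Z : Matrix (Fin m₁) (Fin m₂) ℝ} (hZ : Ω Z ≤ 1) : matInner X Z ≤ dualNorm Ω X := by
  obtain ⟨C, hC⟩ := hΩ X
  refine le_csSup ⟨|C|, ?_⟩ ⟨Z, hZ, rfl⟩
  rintro r ⟨W, hW, rfl⟩
  calc matInner X W ≤ C * Ω W := hC W
    _ ≤ |C| * 1 := mul_le_mul (le_abs_self C) hW (apply_nonneg _ _) (abs_nonneg _)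
    _ = |C| := mul_one _

lemma dualNorm_nonneg (hΩ : DominatesFunctionals Ω) (X : Matrix (Fin m₁) (Fin m₂) ℝ) :
    0 ≤ dualNorm Ω X := by
  simpa [matInner_zero_right] using matInner_le_dualNorm hΩ X (Z := 0) (by simp)

lemma matInner_le_dualNorm_mul (hΩ : DominatesFunctionals Ω)
    (X Z : Matrix (Fin m₁) (Fin m₂) ℝ) : matInner X Z ≤ dualNorm Ω X * Ω Z := by
  rcases (apply_nonneg Ω Z).eq_or_lt with h | h
  · obtain ⟨C, hC⟩ := hΩ X
    simpa [← h] using hC Z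
  · have := matInner_le_dualNorm hΩ X (Z := (Ω Z)⁻¹ • Z)
      (by rw [map_smul_eq_mul, Real.norm_of_nonneg (inv_nonneg.2 h.le), inv_mul_cancel₀ h.ne'])
    rwa [matInner_smul_right, inv_mul_le_iff₀ h, mul_comm] at this

/-- The dual norm as a seminorm. -/
noncomputable def dualSeminorm (Ω : Seminorm ℝ (Matrix (Fin m₁) (Fin m₂) ℝ))
    (hΩ : DominatesFunctionals Ω) :
    Seminorm ℝ (Matrix (Fin m₁) (Fin m₂) ℝ) :=
  have hadd : ∀ A B, dualNorm Ω (A + B) ≤ dualNorm Ω A + dualNorm Ω B := fun A B =>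
    dualNorm_le (add_nonneg (dualNorm_nonneg hΩ A) (dualNorm_nonneg hΩ B)) fun Z => by
      rw [matInner_add_left, add_mul]
      exact add_le_add (matInner_le_dualNorm_mul hΩ A Z) (matInner_le_dualNorm_mul hΩ B Z)
  have hsmul : ∀ (c : ℝ) A, dualNorm Ω (c • A) ≤ ‖c‖ * dualNorm Ω A := fun c A =>
    dualNorm_le (mul_nonneg (norm_nonneg _) (dualNorm_nonneg hΩ A)) fun Z => by
      rw [matInner_smul_left, ← matInner_smul_right]
      refine (matInner_le_dualNorm_mul hΩ A _).trans_eq ?_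
      rw [map_smul_eq_mul]; ring
  Seminorm.ofSMulLE (dualNorm Ω)
    (le_antisymm (dualNorm_le le_rfl fun Z => by simp [matInner_eq_sum]) (dualNorm_nonneg hΩ 0))
    hadd hsmul

end Dual

section Denoiser

variable {Ω : Seminorm ℝ (Matrix (Fin m₁) (Fin m₂) ℝ)}

/-- The first-order optimality condition of a denoiser, obtained by comparing the minimizer `Z` with
the points `Z + t (W - Z)` as `t → 0`. -/
lemma IsDenoiser.matInner_le {lam : ℝ} (hlam : 0 ≤ lam) {Y Z : Matrix (Fin m₁) (Fin m₂) ℝ}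
    (h : IsDenoiser Ω lam Y Z) (W : Matrix (Fin m₁) (Fin m₂) ℝ) :
    matInner (Y - Z) (W - Z) ≤ lam * (Ω W - Ω Z) := by
  set c := matInner (Y - Z) (W - Z) with hc
  have key : ∀ t ∈ Set.Ioc (0 : ℝ) 1, c ≤ lam * (Ω W - Ω Z) + t * (frobSq (W - Z) / 2) := by
    rintro t ⟨ht0, ht1⟩
    have h1 := h (Z + t • (W - Z))
    have h2 : Ω (Z + t • (W - Z)) ≤ (1 - t) * Ω Z + t * Ω W := by
      have : Z + t • (W - Z) = (1 - t) • Z + t • W := by module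
      rw [this]
      refine (map_add_le_add Ω _ _).trans_eq ?_
      rw [map_smul_eq_mul, map_smul_eq_mul, Real.norm_of_nonneg ht0.le,
        Real.norm_of_nonneg (sub_nonneg.2 ht1)]
    have h3 : frobSq (Z + t • (W - Z) - Y) =
        frobSq (Z - Y) - 2 * t * c + t ^ 2 * frobSq (W - Z) := by
      have e : Z + t • (W - Z) - Y = t • (W - Z) - (Y - Z) := by abel
      have e' : Z - Y = (-1 : ℝ) • (Y - Z) := by module
      rw [e, e', hc]
      simp only [frobSq_eq_matInner, matInner_sub_left (t • (W - Z)),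
        matInner_sub_right _ (t • (W - Z)), matInner_smul_left, matInner_smul_right]
      rw [matInner_comm (Y - Z) (W - Z)]
      ring
    have h4 := mul_le_mul_of_nonneg_left h2 hlam
    rw [h3] at h1
    refine le_of_mul_le_mul_left ?_ ht0
    nlinarith
  refine le_of_forall_pos_le_add fun ε hε => ?_
  have hD : 0 ≤ frobSq (W - Z) / 2 := by have := frobSq_nonneg (W - Z); positivity
  set D := frobSq (W - Z) / 2
  refine (key (min 1 (ε / (D + 1))) ⟨by positivity, min_le_left _ _⟩).trans ?_
  have : min 1 (ε / (D + 1)) * D ≤ ε / (D + 1) * (D + 1) :=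
    mul_le_mul (min_le_right _ _) (by linarith) hD (by positivity)
  rw [div_mul_cancel₀ _ (by positivity)] at this
  linarith

/-- The deterministic error bound: once `lam` dominates the dual norm of the noise, the terms in
`Ω Z` cancel. -/
lemma IsDenoiser.frobSq_sub_le {σ lam : ℝ} (hσ : 0 < σ) (hΩ : DominatesFunctionals Ω)
    {Zstar G Z : Matrix (Fin m₁) (Fin m₂) ℝ} (hlam : σ * dualNorm Ω G ≤ lam)
    (h : IsDenoiser Ω lam (Zstar + σ • G) Z) :
    frobSq (Z - Zstar) ≤ lam * Ω Zstar - σ * matInner G Zstar := by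
  have hlam0 : 0 ≤ lam := (mul_nonneg hσ.le (dualNorm_nonneg hΩ G)).trans hlam
  have h1 := h.matInner_le hlam0 Zstar
  have h2 : σ * matInner G Z ≤ lam * Ω Z :=
    calc σ * matInner G Z ≤ σ * (dualNorm Ω G * Ω Z) :=
          mul_le_mul_of_nonneg_left (matInner_le_dualNorm_mul hΩ G Z) hσ.le
      _ = σ * dualNorm Ω G * Ω Z := by ring
      _ ≤ lam * Ω Z := mul_le_mul_of_nonneg_right hlam (apply_nonneg _ _)
  have h3 : matInner (Zstar + σ • G - Z) (Zstar - Z) =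
      frobSq (Z - Zstar) + σ * (matInner G Zstar - matInner G Z) := by
    simp only [frobSq_eq_matInner, matInner_sub_left, matInner_sub_right, matInner_add_left,
      matInner_smul_left]
    rw [matInner_comm Z Zstar]
    ring
  rw [h3] at h1
  linarith

/-- The oracle denoiser is a Lipschitz function of the noise. -/
lemma exists_l1Norm_sub_le_of_isOracleDenoiser {σ : ℝ} (hσ : 0 < σ) (hΩ : DominatesFunctionals Ω)
    (Zstar : Matrix (Fin m₁) (Fin m₂) ℝ) :
    ∃ K, 0 ≤ K ∧ ∀ G G' Z Z', IsOracleDenoiser Ω σ Zstar G Z → IsOracleDenoiser Ω σ Zstar G' Z' →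
      l1Norm (Z - Z') ≤ K * l1Norm (G - G') := by
  obtain ⟨C, hC0, hC⟩ := Ω.exists_le_mul_l1Norm
  obtain ⟨D, hD0, hD⟩ := (dualSeminorm Ω hΩ).exists_le_mul_l1Norm
  refine ⟨(m₁ * m₂ : ℝ) * (σ + σ * D * C), by positivity, fun G G' Z Z' h h' => ?_⟩
  have h1 := IsDenoiser.matInner_le (mul_nonneg hσ.le (dualNorm_nonneg hΩ G)) h Z'
  have h2 := IsDenoiser.matInner_le (mul_nonneg hσ.le (dualNorm_nonneg hΩ G')) h' Z
  have h3 : frobSq (Z - Z') ≤ σ * matInner (G - G') (Z - Z') +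
      σ * ((dualNorm Ω G - dualNorm Ω G') * (Ω Z' - Ω Z)) := by
    have e : matInner (Zstar + σ • G - Z) (Z' - Z) + matInner (Zstar + σ • G' - Z') (Z - Z') =
        frobSq (Z - Z') - σ * matInner (G - G') (Z - Z') := by
      simp only [frobSq_eq_matInner, matInner_sub_left, matInner_sub_right, matInner_add_left,
        matInner_smul_left]
      ring
    linarith
  set d := l1Norm (Z - Z') with hd
  set g := l1Norm (G - G') with hg
  have hd0 : 0 ≤ d := l1Norm_nonneg _
  have hg0 : 0 ≤ g := l1Norm_nonneg _
  have h4 : matInner (G - G') (Z - Z') ≤ g * d := matInner_le_mul_l1Norm (abs_le_l1Norm _)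
  have h5 : |dualNorm Ω G - dualNorm Ω G'| ≤ D * g :=
    (abs_sub_map_le_sub (dualSeminorm Ω hΩ) G G').trans (hD _)
  have h6 : |Ω Z' - Ω Z| ≤ C * d := by
    rw [abs_sub_comm]; exact (abs_sub_map_le_sub Ω Z Z').trans (hC _)
  have h7 : (dualNorm Ω G - dualNorm Ω G') * (Ω Z' - Ω Z) ≤ D * g * (C * d) := by
    refine (le_abs_self _).trans ?_
    rw [abs_mul]
    exact mul_le_mul h5 h6 (abs_nonneg _) (by positivity)
  have h8 : d ^ 2 ≤ (m₁ * m₂ : ℝ) * (σ + σ * D * C) * g * d :=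
    calc d ^ 2 ≤ (m₁ * m₂ : ℝ) * frobSq (Z - Z') := sq_l1Norm_le _
      _ ≤ (m₁ * m₂ : ℝ) * (σ * (g * d) + σ * (D * g * (C * d))) := by
        refine mul_le_mul_of_nonneg_left (h3.trans ?_) (by positivity)
        gcongr
      _ = _ := by ring
  rcases hd0.eq_or_lt with h0 | h0
  · rw [← h0]; positivity
  · rw [sq] at h8
    exact le_of_mul_le_mul_right h8 h0

end Denoiser

end Deterministic

/-! ### The `(k,q)`-trace norm -/

section AtomicNorm

variable {m₁ m₂ k q : ℕ}

lemma neg_mem_sparseUnit {n j : ℕ} {a : EuclideanSpace ℝ (Fin n)} (ha : a ∈ sparseUnit n j) :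
    -a ∈ sparseUnit n j := by
  simpa [sparseUnit] using ha

lemma single_mem_sparseUnit {n j : ℕ} (hj : 1 ≤ j) (i : Fin n) :
    EuclideanSpace.single i (1 : ℝ) ∈ sparseUnit n j := by
  refine ⟨?_, by simp⟩
  have : {l | (EuclideanSpace.single i (1 : ℝ)) l ≠ 0} = {i} := by
    ext l; simp
  rw [this, Set.ncard_singleton]
  exact hj

lemma mem_sparseUnit_self_iff {n : ℕ} {a : EuclideanSpace ℝ (Fin n)} :
    a ∈ sparseUnit n n ↔ ‖a‖ = 1 := by
  refine ⟨fun h => h.2, fun h => ⟨?_, h⟩⟩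
  refine (Set.ncard_le_ncard (Set.subset_univ _)).trans ?_
  simp [Set.ncard_univ]

lemma sum_sq_eq_one_of_norm {n : ℕ} {a : EuclideanSpace ℝ (Fin n)} (ha : ‖a‖ = 1) :
    ∑ i, a i ^ 2 = 1 := by
  rw [← EuclideanSpace.real_norm_sq_eq, ha, one_pow]

lemma neg_mem_kqAtoms {A : Matrix (Fin m₁) (Fin m₂) ℝ} (hA : A ∈ kqAtoms m₁ m₂ k q) :
    -A ∈ kqAtoms m₁ m₂ k q := by
  obtain ⟨a, ha, b, hb, rfl⟩ := hA
  exact ⟨-a, neg_mem_sparseUnit ha, b, hb, by ext; simp⟩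

lemma single_mem_kqAtoms (hk : 1 ≤ k) (hq : 1 ≤ q) (i : Fin m₁) (j : Fin m₂) :
    Matrix.single i j (1 : ℝ) ∈ kqAtoms m₁ m₂ k q := by
  refine ⟨_, single_mem_sparseUnit hk i, _, single_mem_sparseUnit hq j, ?_⟩
  ext p r
  simp only [Matrix.single, Matrix.of_apply, PiLp.single_apply]
  split_ifs <;> grind

lemma abs_le_one_of_mem_kqAtoms {A : Matrix (Fin m₁) (Fin m₂) ℝ} (hA : A ∈ kqAtoms m₁ m₂ k q)
    (i : Fin m₁) (j : Fin m₂) : |A i j| ≤ 1 := by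
  obtain ⟨a, ha, b, hb, rfl⟩ := hA
  have h1 : |a i| ≤ 1 := by simpa [ha.2] using PiLp.norm_apply_le a i
  have h2 : |b j| ≤ 1 := by simpa [hb.2] using PiLp.norm_apply_le b j
  simpa [abs_mul] using mul_le_mul h1 h2 (abs_nonneg _) zero_le_one

lemma neg_mem_convexHull_kqAtoms {A : Matrix (Fin m₁) (Fin m₂) ℝ}
    (hA : A ∈ convexHull ℝ (kqAtoms m₁ m₂ k q)) : -A ∈ convexHull ℝ (kqAtoms m₁ m₂ k q) := by
  have : A ∈ -convexHull ℝ (kqAtoms m₁ m₂ k q) := by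
    rw [← convexHull_neg]
    refine convexHull_mono (fun B hB => ?_) hA
    exact Set.mem_neg.2 (neg_mem_kqAtoms hB)
  exact Set.mem_neg.1 this

/-- A matrix with small entries is the average of multiples `c • E_{ij}`, `|c| ≤ 1`, of matrix
units, each of which lies on the segment between two atoms. -/
lemma mem_convexHull_kqAtoms_of_small (hk : 1 ≤ k) (hq : 1 ≤ q) (hm₁ : 1 ≤ m₁) (hm₂ : 1 ≤ m₂)
    {Z : Matrix (Fin m₁) (Fin m₂) ℝ} (hZ : ∀ i j, (m₁ * m₂ : ℝ) * |Z i j| ≤ 1) :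
    Z ∈ convexHull ℝ (kqAtoms m₁ m₂ k q) := by
  have hN : (0 : ℝ) < m₁ * m₂ := by positivity
  have hconv := convex_convexHull ℝ (kqAtoms m₁ m₂ k q)
  have hseg : ∀ i j, ∀ c : ℝ, |c| ≤ 1 →
      c • Matrix.single i j (1 : ℝ) ∈ convexHull ℝ (kqAtoms m₁ m₂ k q) := by
    intro i j c hc
    have h1 := subset_convexHull ℝ _ (single_mem_kqAtoms hk hq i j)
    have h2 := neg_mem_convexHull_kqAtoms h1
    rw [abs_le] at hc
    have := hconv h1 h2 (a := (1 + c) / 2) (b := (1 - c) / 2) (by linarith) (by linarith) (by ring)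
    convert! this using 1
    module
  have hsum := hconv.sum_mem (t := (univ : Finset (Fin m₁ × Fin m₂)))
    (w := fun _ => (m₁ * m₂ : ℝ)⁻¹)
    (z := fun p => ((m₁ * m₂ : ℝ) * Z p.1 p.2) • Matrix.single p.1 p.2 (1 : ℝ))
    (fun _ _ => by positivity) (by simp; field_simp)
    (fun p _ => hseg _ _ _ (by rw [abs_mul, abs_of_pos hN]; exact hZ _ _))
  convert! hsum using 1
  rw [Fintype.sum_prod_type]
  conv_lhs => rw [Matrix.matrix_eq_sum_single Z]
  refine Finset.sum_congr rfl fun i _ => Finset.sum_congr rfl fun j _ => ?_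
  rw [smul_smul, inv_mul_cancel_left₀ hN.ne', Matrix.smul_single]
  simp

lemma absorbent_convexHull_kqAtoms (hk : 1 ≤ k) (hq : 1 ≤ q) (hm₁ : 1 ≤ m₁) (hm₂ : 1 ≤ m₂) :
    Absorbent ℝ (convexHull ℝ (kqAtoms m₁ m₂ k q)) := by
  rw [absorbent_iff_eventually_nhdsNE_zero]
  intro Z
  have hcont : Filter.Tendsto (fun c : ℝ => (m₁ * m₂ : ℝ) * (|c| * l1Norm Z))
      (nhdsWithin 0 {0}ᶜ) (nhds 0) := by
    have : Continuous fun c : ℝ => (m₁ * m₂ : ℝ) * (|c| * l1Norm Z) := by fun_prop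
    simpa using (this.tendsto 0).mono_left nhdsWithin_le_nhds
  filter_upwards [hcont.eventually_le_const zero_lt_one] with c hc
  refine mem_convexHull_kqAtoms_of_small hk hq hm₁ hm₂ fun i j => le_trans ?_ hc
  rw [Matrix.smul_apply, smul_eq_mul, abs_mul]
  gcongr
  exact abs_le_l1Norm Z i j

/-- The `(k,q)`-trace norm as a seminorm. -/
noncomputable def kqSeminorm (hk : 1 ≤ k) (hq : 1 ≤ q) (hm₁ : 1 ≤ m₁) (hm₂ : 1 ≤ m₂) :
    Seminorm ℝ (Matrix (Fin m₁) (Fin m₂) ℝ) :=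
  Seminorm.of (kqTraceNorm k q)
    (gauge_add_le (convex_convexHull ℝ _) (absorbent_convexHull_kqAtoms hk hq hm₁ hm₂))
    (fun c Z => by
      have hneg : ∀ A ∈ convexHull ℝ (kqAtoms m₁ m₂ k q), -A ∈ convexHull ℝ (kqAtoms m₁ m₂ k q) :=
        fun A hA => neg_mem_convexHull_kqAtoms hA
      have : kqTraceNorm k q (c • Z) = kqTraceNorm k q (|c| • Z) := by
        rcases abs_choice c with h | h <;> rw [h]
        rw [neg_smul, kqTraceNorm, kqTraceNorm, gauge_neg hneg]
      rw [this, kqTraceNorm, gauge_smul_of_nonneg (abs_nonneg c)]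
      rfl)

lemma kqTraceNorm_le_one_of_mem {A : Matrix (Fin m₁) (Fin m₂) ℝ}
    (hA : A ∈ kqAtoms m₁ m₂ k q) : kqTraceNorm k q A ≤ 1 :=
  gauge_le_one_of_mem (subset_convexHull ℝ _ hA)

/-- A linear functional is controlled by its values on the atoms. -/
lemma matInner_le_mul_kqTraceNorm (hk : 1 ≤ k) (hq : 1 ≤ q) (hm₁ : 1 ≤ m₁) (hm₂ : 1 ≤ m₂)
    {X : Matrix (Fin m₁) (Fin m₂) ℝ} {M : ℝ} (hM : 0 ≤ M)
    (h : ∀ A ∈ kqAtoms m₁ m₂ k q, matInner X A ≤ M) (Z : Matrix (Fin m₁) (Fin m₂) ℝ) :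
    matInner X Z ≤ M * kqTraceNorm k q Z := by
  have hhull : ∀ A ∈ convexHull ℝ (kqAtoms m₁ m₂ k q), matInner X A ≤ M := fun A hA =>
    convexHull_min (s := kqAtoms m₁ m₂ k q) (t := {A | matInnerₗ X A ≤ M}) h
      (convex_halfSpace_le (matInnerₗ X).isLinear M) hA
  have key : ∀ r, kqTraceNorm k q Z < r → matInner X Z ≤ M * r := by
    intro r hr
    obtain ⟨t, ht0, htr, Y, hY, rfl⟩ :=
      exists_lt_of_gauge_lt (absorbent_convexHull_kqAtoms hk hq hm₁ hm₂) hr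
    change matInner X (t • Y) ≤ M * r
    rw [matInner_smul_right]
    calc t * matInner X Y ≤ t * M := mul_le_mul_of_nonneg_left (hhull Y hY) ht0.le
      _ ≤ r * M := mul_le_mul_of_nonneg_right htr.le hM
      _ = M * r := mul_comm _ _
  have hlim : Filter.Tendsto (fun r : ℝ => M * r)
      (nhdsWithin (kqTraceNorm k q Z) (Set.Ioi (kqTraceNorm k q Z)))
      (nhds (M * kqTraceNorm k q Z)) := by
    have : Continuous fun r : ℝ => M * r := by fun_prop
    exact (this.tendsto _).mono_left nhdsWithin_le_nhds
  exact ge_of_tendsto hlim (Filter.eventually_of_mem self_mem_nhdsWithin key)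

lemma dominatesFunctionals_kqSeminorm (hk : 1 ≤ k) (hq : 1 ≤ q) (hm₁ : 1 ≤ m₁) (hm₂ : 1 ≤ m₂) :
    DominatesFunctionals (kqSeminorm hk hq hm₁ hm₂) := fun X =>
  ⟨l1Norm X, matInner_le_mul_kqTraceNorm hk hq hm₁ hm₂ (l1Norm_nonneg X) fun A hA => by
    rw [matInner_comm]
    simpa using matInner_le_mul_l1Norm (Z := X) (abs_le_one_of_mem_kqAtoms hA)⟩

end AtomicNorm

/-! ### The trace norm as an atomic norm -/

section TraceNorm

variable {m₁ m₂ : ℕ}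

/-- A singular value decomposition `Z = ∑ (w i) (v i)ᵀ`, where `v` is an orthonormal basis of
eigenvectors of `Zᵀ Z` and the vectors `w i = Z (v i)` are orthogonal, of length the `i`-th singular
value. -/
lemma exists_singular_decomposition (Z : Matrix (Fin m₁) (Fin m₂) ℝ) :
    ∃ (s : Fin m₂ → ℝ) (v : OrthonormalBasis (Fin m₂) ℝ (EuclideanSpace ℝ (Fin m₂)))
      (w : Fin m₂ → EuclideanSpace ℝ (Fin m₁)),
      (∀ i, 0 ≤ s i) ∧ (∀ i j, inner ℝ (w i) (w j) = if i = j then s i ^ 2 else 0) ∧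
      (∀ i p, w i p = ∑ r, Z p r * v i r) ∧ (∀ p r, Z p r = ∑ i, w i p * v i r) ∧
      traceNorm Z = ∑ i, s i := by
  have hn : Module.finrank ℝ (EuclideanSpace ℝ (Fin m₂)) = m₂ := by simp
  have hsum : traceNorm Z = ∑ i : Fin m₂, (Matrix.toEuclideanLin Z).singularValues i := by
    simp only [traceNorm, Finset.sum_range]
  have hTv : ∀ x p, Matrix.toEuclideanLin Z x p = ∑ r, Z p r * x r := fun x p => by
    simp [Matrix.toLpLin_apply, Matrix.mulVec, dotProduct]
  generalize Matrix.toEuclideanLin Z = T at hsum hTv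
  have horth : ∀ i j, inner ℝ (T (T.isSymmetric_adjoint_comp_self.eigenvectorBasis hn i))
      (T (T.isSymmetric_adjoint_comp_self.eigenvectorBasis hn j)) =
      if i = j then T.singularValues i ^ 2 else 0 := by
    intro i j
    rw [← LinearMap.adjoint_inner_left, ← LinearMap.comp_apply,
      T.isSymmetric_adjoint_comp_self.apply_eigenvectorBasis hn i, inner_smul_left,
      orthonormal_iff_ite.1 (OrthonormalBasis.orthonormal _) i j, T.sq_singularValues_fin hn i]
    simp
  generalize T.isSymmetric_adjoint_comp_self.eigenvectorBasis hn = v at horth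
  refine ⟨fun i => T.singularValues i, v, fun i => T (v i), fun i => T.singularValues_nonneg i,
    horth, fun i p => hTv _ p, fun p r => ?_, hsum⟩
  have h1 : T (EuclideanSpace.single r 1) p = Z p r := by simp [hTv]
  have h2 : T (EuclideanSpace.single r 1) = ∑ i, v i r • T (v i) := by
    conv_lhs => rw [← v.sum_repr (EuclideanSpace.single r 1)]
    rw [map_sum]
    refine Finset.sum_congr rfl fun i _ => ?_
    rw [map_smul, v.repr_apply_apply, EuclideanSpace.inner_single_right]
    simp
  rw [← h1, h2]
  simp only [WithLp.ofLp_sum, Finset.sum_apply, PiLp.smul_apply, smul_eq_mul]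
  exact Finset.sum_congr rfl fun i _ => mul_comm _ _

/-- The sum of the singular values is the atomic norm of the unit rank-one matrices. With right
singular vectors `v i` and singular values `s i`, the decomposition `Z = ∑ (Z v i) (v i)ᵀ` gives one
inequality; the other is duality against `W = ∑ (s i)⁻¹ (Z v i) (v i)ᵀ`, which is at most `1` on
atoms and has `⟨W, Z⟩ = ∑ s i`. -/
lemma traceNorm_eq_kqTraceNorm (hm₁ : 1 ≤ m₁) (hm₂ : 1 ≤ m₂)
    (Z : Matrix (Fin m₁) (Fin m₂) ℝ) : traceNorm Z = kqTraceNorm m₁ m₂ Z := by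
  obtain ⟨s, v, w, hs0, horth, hw, hZ, hsum⟩ := exists_singular_decomposition Z
  have hrank1 : ∀ (u : EuclideanSpace ℝ (Fin m₁)) (x : EuclideanSpace ℝ (Fin m₂)),
      ‖u‖ = 1 → ‖x‖ = 1 →
      (Matrix.of fun p r => u p * x r) ∈ kqAtoms m₁ m₂ m₁ m₂ := fun u x hu hx =>
    ⟨u, mem_sparseUnit_self_iff.2 hu, x, mem_sparseUnit_self_iff.2 hx, rfl⟩
  have hnorm : ∀ i, ‖w i‖ = s i := fun i => by
    rw [← sq_eq_sq₀ (norm_nonneg _) (hs0 i), ← real_inner_self_eq_norm_sq, horth, if_pos rfl]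
  rw [hsum]
  refine le_antisymm ?_ ?_
  · -- terms with `s i = 0` drop out of `W`, since `0⁻¹ = 0`
    set W : Matrix (Fin m₁) (Fin m₂) ℝ := Matrix.of fun p r => ∑ i, (s i)⁻¹ * (w i p * v i r)
    have hW : ∀ A : Matrix (Fin m₁) (Fin m₂) ℝ,
        matInner W A = ∑ i, (s i)⁻¹ * ∑ p, w i p * ∑ r, A p r * v i r := by
      intro A
      simp only [matInner_eq_sum, W, Matrix.of_apply, Finset.sum_mul, Finset.mul_sum]
      rw [Finset.sum_comm]
      conv_lhs => enter [2, r]; rw [Finset.sum_comm]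
      rw [Finset.sum_comm]
      refine Finset.sum_congr rfl fun i _ => ?_
      rw [Finset.sum_comm]
      exact Finset.sum_congr rfl fun p _ => Finset.sum_congr rfl fun r _ => by ring
    have hWZ : matInner W Z = ∑ i, s i := by
      rw [hW]
      refine Finset.sum_congr rfl fun i _ => ?_
      have : ∑ p, w i p * ∑ r, Z p r * v i r = s i ^ 2 := by
        rw [← hnorm, EuclideanSpace.real_norm_sq_eq]
        exact Finset.sum_congr rfl fun p _ => by rw [← hw, sq]
      rw [this]
      rcases (hs0 i).eq_or_lt with h | h
      · simp [← h]
      · field_simp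
    have hWatom : ∀ A ∈ kqAtoms m₁ m₂ m₁ m₂, matInner W A ≤ 1 := by
      rintro A ⟨a, ha, b, hb, rfl⟩
      set y : EuclideanSpace ℝ (Fin m₁) := ∑ i, (inner ℝ (v i) b * (s i)⁻¹) • w i
      have h1 : matInner W (Matrix.of fun p r => a p * b r) = inner ℝ y a := by
        rw [hW, sum_inner]
        refine Finset.sum_congr rfl fun i _ => ?_
        rw [real_inner_smul_left]
        simp only [PiLp.inner_apply, Matrix.of_apply, RCLike.inner_apply, conj_trivial,
          Finset.mul_sum, Finset.sum_mul]
        refine Finset.sum_congr rfl fun p _ => Finset.sum_congr rfl fun r _ => by ring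
      have h2 : ‖y‖ ^ 2 ≤ 1 := by
        rw [← real_inner_self_eq_norm_sq]
        simp only [y, sum_inner, inner_sum, real_inner_smul_left, real_inner_smul_right, horth]
        have hb2 : ∑ i, inner ℝ (v i) b ^ 2 = 1 := by
          have := v.sum_sq_norm_inner_right b
          simpa [hb.2] using this
        rw [← hb2]
        refine Finset.sum_le_sum fun i _ => ?_
        simp only [mul_ite, mul_zero, Finset.sum_ite_eq', mem_univ, if_true]
        rcases (hs0 i).eq_or_lt with h | h
        · simp [← h]; positivity
        · exact le_of_eq (by field_simp)
      rw [h1]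
      calc inner ℝ y a ≤ ‖y‖ * ‖a‖ := real_inner_le_norm y a
        _ ≤ 1 := by
          rw [ha.2, mul_one]
          exact (sq_le_one_iff₀ (norm_nonneg _)).1 h2
    have := matInner_le_mul_kqTraceNorm hm₁ hm₂ hm₁ hm₂ zero_le_one hWatom Z
    rwa [hWZ, one_mul] at this
  · set p := kqSeminorm hm₁ hm₂ hm₁ hm₂
    have hdec : Z = ∑ i, Matrix.of fun p r => w i p * v i r := by
      ext p r
      rw [Matrix.sum_apply, hZ]
      rfl
    conv_lhs => rw [hdec]
    refine (Finset.le_sum_of_subadditive p (map_zero p).le (map_add_le_add p) _ _).trans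
      (Finset.sum_le_sum fun i _ => ?_)
    rcases (hs0 i).eq_or_lt with h | h
    · have h0 : w i = 0 := by rw [← norm_eq_zero, hnorm, ← h]
      have : (Matrix.of fun p r => w i p * v i r) = 0 := by ext; simp [h0]
      rw [this, map_zero]
      exact hs0 i
    · have hu : ‖(s i)⁻¹ • w i‖ = 1 := by
        rw [norm_smul, hnorm, norm_inv, Real.norm_of_nonneg h.le, inv_mul_cancel₀ h.ne']
      have : (Matrix.of fun p r => w i p * v i r) =
          s i • Matrix.of fun p r => ((s i)⁻¹ • w i) p * v i r := by
        ext p r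
        simp only [Matrix.smul_apply, Matrix.of_apply, PiLp.smul_apply, smul_eq_mul]
        field_simp
      rw [this, map_smul_eq_mul, Real.norm_of_nonneg h.le]
      exact mul_le_of_le_one_right h.le
        (kqTraceNorm_le_one_of_mem (hrank1 _ _ hu (v.orthonormal.1 i)))

end TraceNorm

/-! ### The Cameron–Martin formula -/

section CameronMartin

open scoped NNReal ENNReal

lemma gaussianReal_eq_withDensity_exp (c : ℝ) {v : ℝ≥0} (hv : v ≠ 0) :
    gaussianReal c v = (gaussianReal 0 v).withDensity
      fun x => ENNReal.ofReal (Real.exp ((c * x - c ^ 2 / 2) / v)) := by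
  have hv' : (v : ℝ) ≠ 0 := by simpa using hv
  rw [gaussianReal_of_var_ne_zero _ hv, gaussianReal_of_var_ne_zero _ hv,
    ← withDensity_mul _ (measurable_gaussianPDF 0 v) (by fun_prop)]
  congr 1
  ext1 x
  rw [Pi.mul_apply, gaussianPDF, gaussianPDF, ← ENNReal.ofReal_mul (gaussianPDFReal_nonneg _ _ _)]
  congr 1
  rw [gaussianPDFReal, gaussianPDFReal, mul_assoc (_⁻¹), ← Real.exp_add]
  congr 2
  field_simp
  ring

variable {ι : Type*} [Fintype ι]

lemma pi_gaussianReal_eq_withDensity_exp (c : ι → ℝ) {v : ι → ℝ≥0} (hv : ∀ i, v i ≠ 0) :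
    Measure.pi (fun i => gaussianReal (c i) (v i)) =
      (Measure.pi fun i => gaussianReal 0 (v i)).withDensity fun x =>
        ENNReal.ofReal (Real.exp (∑ i, (c i * x i - c i ^ 2 / 2) / v i)) := by
  refine Measure.pi_eq fun s hs => ?_
  set f : ι → ℝ → ℝ≥0∞ := fun i x =>
    (s i).indicator (fun x => ENNReal.ofReal (Real.exp ((c i * x - c i ^ 2 / 2) / v i))) x with hf
  have hfm : ∀ i, Measurable (f i) := fun i =>
    Measurable.indicator (by fun_prop) (hs i)
  rw [withDensity_apply _ (.univ_pi hs), ← lintegral_indicator (.univ_pi hs)]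
  have h1 : ∀ x : ι → ℝ, (Set.univ.pi s).indicator (fun x =>
      ENNReal.ofReal (Real.exp (∑ i, (c i * x i - c i ^ 2 / 2) / v i))) x = ∏ i, f i (x i) := by
    intro x
    by_cases hx : x ∈ Set.univ.pi s
    · rw [Set.indicator_of_mem hx, Real.exp_sum,
        ENNReal.ofReal_prod_of_nonneg fun i _ => (Real.exp_pos _).le]
      refine Finset.prod_congr rfl fun i _ => ?_
      rw [hf]
      simp only [Set.indicator_of_mem (hx i (Set.mem_univ i))]
    · rw [Set.indicator_of_notMem hx]
      simp only [Set.mem_univ_pi, not_forall] at hx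
      obtain ⟨i, hi⟩ := hx
      refine (Finset.prod_eq_zero (mem_univ i) ?_).symm
      simp only [hf, Set.indicator_of_notMem hi]
  rw [lintegral_congr h1, lintegral_prod_eq_prod_lintegral_of_indepFun univ
    (fun i (x : ι → ℝ) => f i (x i)) (iIndepFun_pi fun i => (hfm i).aemeasurable)
    (fun i => (hfm i).comp (measurable_pi_apply i))]
  refine Finset.prod_congr rfl fun i _ => ?_
  rw [(measurePreserving_eval (fun i => gaussianReal 0 (v i)) i).lintegral_comp (hfm i), hf,
    lintegral_indicator (hs i), gaussianReal_eq_withDensity_exp (c i) (hv i),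
    withDensity_apply _ (hs i)]

/-- The Cameron–Martin formula for a product of centred Gaussian measures. -/
lemma lintegral_pi_gaussianReal_shift (c : ι → ℝ) {v : ι → ℝ≥0} (hv : ∀ i, v i ≠ 0)
    {F : (ι → ℝ) → ℝ≥0∞} (hF : Measurable F) :
    ∫⁻ x, F x ∂Measure.pi (fun i => gaussianReal 0 (v i)) =
      ∫⁻ x, ENNReal.ofReal (Real.exp (∑ i, (-c i * x i - c i ^ 2 / 2) / v i)) *
        F (x + c) ∂Measure.pi (fun i => gaussianReal 0 (v i)) := by
  have h1 : (Measure.pi fun i => gaussianReal 0 (v i)) =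
      (Measure.pi fun i => gaussianReal (-c i) (v i)).map fun x i => x i + c i := by
    rw [Measure.pi_map_pi (f := fun i y => y + c i) fun i => by fun_prop]
    simp only [gaussianReal_map_add_const, neg_add_cancel]
  conv_lhs => rw [h1]
  have hFc : Measurable fun x : ι → ℝ => F fun i => x i + c i :=
    hF.comp (by fun_prop : Measurable fun (x : ι → ℝ) i => x i + c i)
  rw [lintegral_map hF (by fun_prop), pi_gaussianReal_eq_withDensity_exp _ hv,
    lintegral_withDensity_eq_lintegral_mul _ (by fun_prop) hFc]
  simp only [Pi.mul_apply, neg_sq]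
  rfl

end CameronMartin

/-! ### Moments of Gaussian product measures -/

section Moments

open scoped NNReal

variable {ι : Type*} [Fintype ι] (v : ι → ℝ≥0)

lemma integrable_add_gaussianReal (u : ℝ) (w : ℝ≥0) :
    Integrable (fun x => x + u) (gaussianReal 0 w) :=
  ((memLp_id_gaussianReal 1).integrable (by simp)).add (integrable_const u)

lemma integral_add_gaussianReal (u : ℝ) (w : ℝ≥0) :
    ∫ x, (x + u) ∂gaussianReal 0 w = u := by
  have h : Integrable (fun x : ℝ => x) (gaussianReal 0 w) :=
    (memLp_id_gaussianReal 1).integrable (by simp)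
  rw [integral_add h (integrable_const u)]
  simp [integral_id_gaussianReal]

lemma integrable_add_sq_gaussianReal (u : ℝ) (w : ℝ≥0) :
    Integrable (fun x => (x + u) ^ 2) (gaussianReal 0 w) :=
  ((memLp_id_gaussianReal 2).add (memLp_const u)).integrable_sq

lemma integral_add_sq_gaussianReal (u : ℝ) (w : ℝ≥0) :
    ∫ x, (x + u) ^ 2 ∂gaussianReal 0 w = w + u ^ 2 := by
  have h := variance_eq_sub (μ := gaussianReal 0 w) (X := fun x => x + u)
    ((memLp_id_gaussianReal 2).add (memLp_const u))
  have h2 : Var[fun x => x + u; gaussianReal 0 w] = w := by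
    rw [variance_add_const (by fun_prop), variance_fun_id_gaussianReal]
  rw [h2, integral_add_gaussianReal] at h
  have : ∫ x, (x + u) ^ 2 ∂gaussianReal 0 w = (gaussianReal 0 w)[(fun x => x + u) ^ 2] := rfl
  rw [this]
  linarith

lemma indepFun_eval_pi_gaussianReal {f g : ℝ → ℝ} (hf : Measurable f) (hg : Measurable g)
    {i j : ι} (hij : i ≠ j) :
    IndepFun (fun x : ι → ℝ => f (x i)) (fun x => g (x j))
      (Measure.pi fun i => gaussianReal 0 (v i)) :=
  ((iIndepFun_pi (X := fun _ => id) (μ := fun i => gaussianReal 0 (v i))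
    fun _ => aemeasurable_id).indepFun hij).comp hf hg

lemma integrable_mul_eval_pi_gaussianReal {f g : ℝ → ℝ} (hf : Measurable f) (hg : Measurable g)
    {i j : ι} (hij : i ≠ j) (hfi : Integrable f (gaussianReal 0 (v i)))
    (hgi : Integrable g (gaussianReal 0 (v j))) :
    Integrable (fun x : ι → ℝ => f (x i) * g (x j)) (Measure.pi fun i => gaussianReal 0 (v i)) :=
  (indepFun_eval_pi_gaussianReal v hf hg hij).integrable_mul (integrable_comp_eval hfi)
    (integrable_comp_eval hgi)

lemma integral_mul_eval_pi_gaussianReal {f g : ℝ → ℝ} (hf : Measurable f) (hg : Measurable g)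
    {i j : ι} (hij : i ≠ j) :
    ∫ x : ι → ℝ, f (x i) * g (x j) ∂(Measure.pi fun i => gaussianReal 0 (v i)) =
      (∫ x, f x ∂gaussianReal 0 (v i)) * ∫ x, g x ∂gaussianReal 0 (v j) := by
  rw [(indepFun_eval_pi_gaussianReal v hf hg hij).integral_fun_mul_eq_mul_integral
    (hf.comp (measurable_pi_apply i)).aestronglyMeasurable
    (hg.comp (measurable_pi_apply j)).aestronglyMeasurable,
    integral_comp_eval (μ := fun i => gaussianReal 0 (v i)) hf.aestronglyMeasurable,
    integral_comp_eval (μ := fun i => gaussianReal 0 (v i)) hg.aestronglyMeasurable]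

end Moments

/-! ### Gaussian smoothing of exponential weights -/

section GaussianSmoothing

open scoped NNReal ENNReal

variable {m₁ m₂ : ℕ}

/-- The exponential `exp (lam xᵀ G y - lam² |x|² |y|² / 2)`, restricted to the coordinates of `x` in
`I` and those of `y` in `J`. It has mean one when `G` is a standard Gaussian matrix. The pair
`(x, y)` is encoded as a single vector `z` indexed by `Fin m₁ ⊕ Fin m₂`. -/
noncomputable def expWeight (lam : ℝ) (I : Finset (Fin m₁)) (J : Finset (Fin m₂))
    (g : Fin m₁ → Fin m₂ → ℝ) (z : Fin m₁ ⊕ Fin m₂ → ℝ) : ℝ :=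
  Real.exp (lam * ∑ p ∈ I ×ˢ J, g p.1 p.2 * (z (.inl p.1) * z (.inr p.2)) -
    lam ^ 2 / 2 * ∑ p ∈ I ×ˢ J, z (.inl p.1) ^ 2 * z (.inr p.2) ^ 2)

/-- The variances of the smoothing Gaussian vector `(x, y)`: `1 / k` for the coordinates of `x` and
`1 / q` for those of `y`. -/
noncomputable def smoothingVar (m₁ m₂ k q : ℕ) : Fin m₁ ⊕ Fin m₂ → ℝ≥0 :=
  Sum.elim (fun _ => (k : ℝ≥0)⁻¹) (fun _ => (q : ℝ≥0)⁻¹)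

/-- The average of `expWeight` over a centred Gaussian vector `(x, y)`. -/
noncomputable def smoothedWeight (k q : ℕ) (lam : ℝ) (I : Finset (Fin m₁)) (J : Finset (Fin m₂))
    (g : Fin m₁ → Fin m₂ → ℝ) : ℝ≥0∞ :=
  ∫⁻ z, ENNReal.ofReal (expWeight lam I J g z)
    ∂Measure.pi fun i => gaussianReal 0 (smoothingVar m₁ m₂ k q i)

lemma measurable_expWeight (lam : ℝ) (I : Finset (Fin m₁)) (J : Finset (Fin m₂)) :
    Measurable fun w : (Fin m₁ → Fin m₂ → ℝ) × (Fin m₁ ⊕ Fin m₂ → ℝ) =>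
      expWeight lam I J w.1 w.2 := by
  unfold expWeight
  fun_prop

lemma measurable_smoothedWeight (k q : ℕ) (lam : ℝ) (I : Finset (Fin m₁)) (J : Finset (Fin m₂)) :
    Measurable (smoothedWeight k q lam I J) :=
  (measurable_expWeight lam I J).ennreal_ofReal.lintegral_prod_right'

section Expectation

variable {S : Type*} [MeasurableSpace S] {P : Measure S}
  {G : S → Matrix (Fin m₁) (Fin m₂) ℝ}

lemma IsStdGaussianMatrix.aemeasurable (hG : IsStdGaussianMatrix G P) :
    AEMeasurable (fun s => (fun i j => G s i j : Fin m₁ → Fin m₂ → ℝ)) P :=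
  aemeasurable_pi_lambda _ fun i => aemeasurable_pi_lambda _ fun j => (hG.1 i j).aemeasurable

lemma IsStdGaussianMatrix.lintegral_expWeight (hG : IsStdGaussianMatrix G P) (lam : ℝ)
    (I : Finset (Fin m₁)) (J : Finset (Fin m₂)) (z : Fin m₁ ⊕ Fin m₂ → ℝ) :
    ∫⁻ s, ENNReal.ofReal (expWeight lam I J (G s) z) ∂P = 1 := by
  set c : Fin m₁ × Fin m₂ → ℝ := fun p => z (.inl p.1) * z (.inr p.2) with hc
  set X : Fin m₁ × Fin m₂ → S → ℝ := fun p s => G s p.1 p.2 * c p with hX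
  have hindep : iIndepFun X P :=
    hG.2.comp (fun p x => x * c p) fun p => by fun_prop
  have hmgf : ∀ p, mgf (X p) P lam = Real.exp (lam ^ 2 / 2 * c p ^ 2) := by
    intro p
    have h1 : mgf (X p) P lam = mgf (fun s => G s p.1 p.2) P (c p * lam) := by
      simp only [mgf, hX]
      congr 1; ext s; congr 1; ring
    rw [h1, mgf_gaussianReal (hG.1 p.1 p.2).map_eq]
    congr 1
    simp only [NNReal.coe_one]
    ring
  have hint : ∫ s, expWeight lam I J (G s) z ∂P = 1 := by
    have h1 := hindep.mgf_sum₀ (t := lam) (fun p => ((hG.1 p.1 p.2).aemeasurable).mul_const _)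
      (I ×ˢ J)
    simp only [hmgf] at h1
    rw [← Real.exp_sum, ← Finset.mul_sum] at h1
    simp only [expWeight, Real.exp_sub]
    rw [integral_div]
    have h2 : ∫ s, Real.exp (lam * ∑ p ∈ I ×ˢ J, G s p.1 p.2 * (z (.inl p.1) * z (.inr p.2))) ∂P =
        mgf (∑ p ∈ I ×ˢ J, X p) P lam := by
      simp only [mgf, Finset.sum_apply, hX, hc]
    rw [h2, h1]
    simp only [hc, mul_pow]
    exact div_self (Real.exp_pos _).ne'
  have hi : Integrable (fun s => expWeight lam I J (G s) z) P := by
    by_contra h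
    rw [integral_undef h] at hint
    exact zero_ne_one hint
  rw [← ofReal_integral_eq_lintegral_ofReal hi (.of_forall fun s => (Real.exp_pos _).le), hint,
    ENNReal.ofReal_one]

lemma lintegral_lintegral_comp_swap {T U : Type*} [MeasurableSpace T] [MeasurableSpace U]
    [SFinite P] {f : S → T} (hf : AEMeasurable f P) (ν : Measure U) [SFinite ν]
    {F : T × U → ℝ≥0∞} (hF : Measurable F) :
    ∫⁻ s, ∫⁻ z, F (f s, z) ∂ν ∂P = ∫⁻ z, ∫⁻ s, F (f s, z) ∂P ∂ν := by
  refine lintegral_lintegral_swap (f := fun s z => F (f s, z)) ?_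
  exact hF.comp_aemeasurable (hf.comp_fst.prodMk measurable_snd.aemeasurable)

lemma IsStdGaussianMatrix.lintegral_smoothedWeight [SFinite P]
    (hG : IsStdGaussianMatrix G P) (k q : ℕ) (lam : ℝ) (I : Finset (Fin m₁))
    (J : Finset (Fin m₂)) :
    ∫⁻ s, smoothedWeight k q lam I J (fun i j => G s i j) ∂P = 1 := by
  have h : ∀ z, ∫⁻ s, ENNReal.ofReal (expWeight lam I J (fun i j => G s i j) z) ∂P = 1 :=
    hG.lintegral_expWeight lam I J
  refine (lintegral_lintegral_comp_swap hG.aemeasurable _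
    (measurable_expWeight lam I J).ennreal_ofReal).trans ?_
  rw [lintegral_congr h, lintegral_one, measure_univ]

end Expectation

lemma ofReal_integral_le_lintegral_ofReal {α : Type*} [MeasurableSpace α] {μ : Measure α}
    {f : α → ℝ} (hf : Integrable f μ) :
    ENNReal.ofReal (∫ x, f x ∂μ) ≤ ∫⁻ x, ENNReal.ofReal (f x) ∂μ := by
  calc ENNReal.ofReal (∫ x, f x ∂μ) ≤ ENNReal.ofReal (∫ x, max (f x) 0 ∂μ) :=
        ENNReal.ofReal_le_ofReal (integral_mono hf hf.pos_part fun x => le_max_left _ _)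
    _ = ∫⁻ x, ENNReal.ofReal (max (f x) 0) ∂μ :=
        ofReal_integral_eq_lintegral_ofReal hf.pos_part (.of_forall fun x => le_max_right _ _)
    _ = ∫⁻ x, ENNReal.ofReal (f x) ∂μ := by simp

/-- Jensen's inequality for `exp`, in the form of integrating the tangent line at `log N`. -/
lemma ofReal_tangent_le_lintegral_exp {α : Type*} [MeasurableSpace α] {μ : Measure α}
    [IsProbabilityMeasure μ] {h : α → ℝ} (hh : Integrable h μ) {N : ℝ} (hN : 0 < N) :
    ENNReal.ofReal (N * (1 + ∫ x, h x ∂μ - Real.log N)) ≤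
      ∫⁻ x, ENNReal.ofReal (Real.exp (h x)) ∂μ := by
  have h1 : Integrable (fun x => 1 + h x) μ := (integrable_const 1).add hh
  have h2 : Integrable (fun x => 1 + h x - Real.log N) μ := h1.sub (integrable_const _)
  have h3 := ofReal_integral_le_lintegral_ofReal (h2.const_mul N)
  rw [integral_const_mul, integral_sub h1 (integrable_const _),
    integral_add (integrable_const 1) hh] at h3
  simp only [integral_const, probReal_univ, one_smul] at h3
  refine h3.trans (lintegral_mono fun x => ENNReal.ofReal_le_ofReal ?_)
  have h4 := Real.add_one_le_exp (h x - Real.log N)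
  rw [Real.exp_sub, Real.exp_log hN, le_div_iff₀ hN] at h4
  linarith

/-- The exponent that appears after recentring the smoothing vector at `c = (u, v)`, for unit
vectors `u` and `v` supported on `I` and `J`, has mean `lam uᵀ g v - 2 lam² - (k + q) / 2`: each of
the second moments of `x` on `I` and of `y` on `J` equals `2`, and the change of measure costs
`(k + q) / 2`. -/
lemma integral_shifted_exponent {k q : ℕ} (hk : 1 ≤ k) (hq : 1 ≤ q) (lam : ℝ)
    {I : Finset (Fin m₁)} {J : Finset (Fin m₂)} (hI : #I = k) (hJ : #J = q)
    (g : Fin m₁ → Fin m₂ → ℝ) {u : Fin m₁ → ℝ} {v : Fin m₂ → ℝ}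
    (hu : ∑ i ∈ I, u i ^ 2 = 1) (hv : ∑ j ∈ J, v j ^ 2 = 1)
    (hu' : ∑ i, u i ^ 2 = 1) (hv' : ∑ j, v j ^ 2 = 1)
    {c : Fin m₁ ⊕ Fin m₂ → ℝ} (hc : c = Sum.elim u v) {w : Fin m₁ ⊕ Fin m₂ → ℝ≥0}
    (hw : w = smoothingVar m₁ m₂ k q) :
    Integrable (fun z => ∑ i, (-c i * z i - c i ^ 2 / 2) / w i +
      (lam * ∑ p ∈ I ×ˢ J, g p.1 p.2 * ((z + c) (.inl p.1) * (z + c) (.inr p.2)) -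
      lam ^ 2 / 2 * ∑ p ∈ I ×ˢ J, (z + c) (.inl p.1) ^ 2 * (z + c) (.inr p.2) ^ 2))
      (Measure.pi fun i => gaussianReal 0 (w i)) ∧
    ∫ z, (∑ i, (-c i * z i - c i ^ 2 / 2) / w i +
      (lam * ∑ p ∈ I ×ˢ J, g p.1 p.2 * ((z + c) (.inl p.1) * (z + c) (.inr p.2)) -
      lam ^ 2 / 2 * ∑ p ∈ I ×ˢ J, (z + c) (.inl p.1) ^ 2 * (z + c) (.inr p.2) ^ 2))
      ∂(Measure.pi fun i => gaussianReal 0 (w i)) =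
    lam * (∑ p ∈ I ×ˢ J, g p.1 p.2 * (u p.1 * v p.2)) - 2 * lam ^ 2 - (k + q) / 2 := by
  set ν := Measure.pi fun i => gaussianReal 0 (w i)
  have hne : ∀ p : Fin m₁ × Fin m₂, (.inl p.1 : Fin m₁ ⊕ Fin m₂) ≠ .inr p.2 := fun p => by simp
  have hlin : ∀ i, Integrable (fun z : Fin m₁ ⊕ Fin m₂ → ℝ => (-c i * z i - c i ^ 2 / 2) / w i) ν :=
    fun i => by
      have : Integrable (fun z : Fin m₁ ⊕ Fin m₂ → ℝ => z i) ν :=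
        integrable_eval (μ := fun i => gaussianReal 0 (w i))
          ((memLp_id_gaussianReal 1).integrable (by simp))
      exact ((this.const_mul _).sub (integrable_const _)).div_const _
  have hbil : ∀ p : Fin m₁ × Fin m₂, Integrable (fun z : Fin m₁ ⊕ Fin m₂ → ℝ =>
      g p.1 p.2 * ((z + c) (.inl p.1) * (z + c) (.inr p.2))) ν := fun p =>
    (integrable_mul_eval_pi_gaussianReal w (f := fun x => x + c (.inl p.1))
      (g := fun x => x + c (.inr p.2)) (by fun_prop) (by fun_prop) (hne p)
      (integrable_add_gaussianReal _ _) (integrable_add_gaussianReal _ _)).const_mul _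
  have hsq : ∀ p : Fin m₁ × Fin m₂, Integrable (fun z : Fin m₁ ⊕ Fin m₂ → ℝ =>
      (z + c) (.inl p.1) ^ 2 * (z + c) (.inr p.2) ^ 2) ν := fun p =>
    integrable_mul_eval_pi_gaussianReal w (f := fun x => (x + c (.inl p.1)) ^ 2)
      (g := fun x => (x + c (.inr p.2)) ^ 2) (by fun_prop) (by fun_prop) (hne p)
      (integrable_add_sq_gaussianReal _ _) (integrable_add_sq_gaussianReal _ _)
  have elin : ∀ i, ∫ z : Fin m₁ ⊕ Fin m₂ → ℝ, (-c i * z i - c i ^ 2 / 2) / w i ∂ν =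
      -(c i ^ 2 / 2) / w i := fun i => by
    have h1 : Integrable (fun z : Fin m₁ ⊕ Fin m₂ → ℝ => z i) ν :=
      integrable_eval (μ := fun i => gaussianReal 0 (w i))
        ((memLp_id_gaussianReal 1).integrable (by simp))
    have h2 : ∫ z : Fin m₁ ⊕ Fin m₂ → ℝ, z i ∂ν = 0 :=
      (integral_eval (μ := fun i => gaussianReal 0 (w i))).trans integral_id_gaussianReal
    rw [integral_div, integral_sub (h1.const_mul _) (integrable_const _), integral_const_mul, h2]
    simp
  have ebil : ∀ p : Fin m₁ × Fin m₂, ∫ z : Fin m₁ ⊕ Fin m₂ → ℝ,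
      g p.1 p.2 * ((z + c) (.inl p.1) * (z + c) (.inr p.2)) ∂ν =
      g p.1 p.2 * (u p.1 * v p.2) := fun p => by
    have h := integral_mul_eval_pi_gaussianReal w (f := fun x => x + c (.inl p.1))
      (g := fun x => x + c (.inr p.2)) (by fun_prop) (by fun_prop) (hne p)
    rw [integral_add_gaussianReal, integral_add_gaussianReal] at h
    rw [integral_const_mul]
    congr 1
    refine h.trans ?_
    simp [hc]
  have esq : ∀ p : Fin m₁ × Fin m₂, ∫ z : Fin m₁ ⊕ Fin m₂ → ℝ,
      (z + c) (.inl p.1) ^ 2 * (z + c) (.inr p.2) ^ 2 ∂ν =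
      ((k : ℝ)⁻¹ + u p.1 ^ 2) * ((q : ℝ)⁻¹ + v p.2 ^ 2) := fun p => by
    have h := integral_mul_eval_pi_gaussianReal w (f := fun x => (x + c (.inl p.1)) ^ 2)
      (g := fun x => (x + c (.inr p.2)) ^ 2) (by fun_prop) (by fun_prop) (hne p)
    rw [integral_add_sq_gaussianReal, integral_add_sq_gaussianReal] at h
    refine h.trans ?_
    simp [hc, hw, smoothingVar]
  have ilin := integrable_finsetSum univ fun i _ => hlin i
  have ibil := (integrable_finsetSum (I ×ˢ J) fun p _ => hbil p).const_mul lam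
  have isq := (integrable_finsetSum (I ×ˢ J) fun p _ => hsq p).const_mul (lam ^ 2 / 2)
  have ibs : Integrable (fun z : Fin m₁ ⊕ Fin m₂ → ℝ =>
      lam * ∑ p ∈ I ×ˢ J, g p.1 p.2 * ((z + c) (.inl p.1) * (z + c) (.inr p.2)) -
      lam ^ 2 / 2 * ∑ p ∈ I ×ˢ J, (z + c) (.inl p.1) ^ 2 * (z + c) (.inr p.2) ^ 2) ν :=
    ibil.sub isq
  refine ⟨ilin.add ibs, ?_⟩
  have hk' : (k : ℝ) ≠ 0 := by positivity
  have hq' : (q : ℝ) ≠ 0 := by positivity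
  have s1 : ∑ i, -(c i ^ 2 / 2) / (w i : ℝ) = -(((k : ℝ) + q) / 2) := by
    rw [Fintype.sum_sum_type]
    have e1 : ∑ i, -(c (.inl i) ^ 2 / 2) / (w (.inl i) : ℝ) = -(k / 2) * ∑ i, u i ^ 2 := by
      rw [Finset.mul_sum]
      refine Finset.sum_congr rfl fun i _ => ?_
      simp [hc, hw, smoothingVar]; ring
    have e2 : ∑ i, -(c (.inr i) ^ 2 / 2) / (w (.inr i) : ℝ) = -(q / 2) * ∑ i, v i ^ 2 := by
      rw [Finset.mul_sum]
      refine Finset.sum_congr rfl fun i _ => ?_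
      simp [hc, hw, smoothingVar]; ring
    rw [e1, e2, hu', hv']
    ring
  have s2 : ∑ p ∈ I ×ˢ J, ((k : ℝ)⁻¹ + u p.1 ^ 2) * ((q : ℝ)⁻¹ + v p.2 ^ 2) = 4 := by
    rw [Finset.sum_product]
    dsimp only
    rw [← Finset.sum_mul_sum, Finset.sum_add_distrib, Finset.sum_add_distrib,
      hu, hv, Finset.sum_const, Finset.sum_const, hI, hJ, nsmul_eq_mul, nsmul_eq_mul,
      mul_inv_cancel₀ hk', mul_inv_cancel₀ hq']
    norm_num
  rw [integral_add ilin ibs, integral_sub ibil isq, integral_const_mul,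
    integral_const_mul, integral_finsetSum _ fun i _ => hlin i,
    integral_finsetSum _ fun p _ => hbil p, integral_finsetSum _ fun p _ => hsq p,
    Finset.sum_congr rfl fun i _ => elin i, Finset.sum_congr rfl fun p _ => ebil p,
    Finset.sum_congr rfl fun p _ => esq p, s1, s2]
  ring

/-- Recentring the smoothing vector at `(u, v)` bounds the smoothed weight from below. The number
`N` is free; it is to be taken close to the value of the weight. -/
lemma ofReal_le_smoothedWeight {k q : ℕ} (hk : 1 ≤ k) (hq : 1 ≤ q) (lam : ℝ)
    {I : Finset (Fin m₁)} {J : Finset (Fin m₂)} (hI : #I = k) (hJ : #J = q)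
    (g : Fin m₁ → Fin m₂ → ℝ) {u : Fin m₁ → ℝ} {v : Fin m₂ → ℝ}
    (hu : ∑ i ∈ I, u i ^ 2 = 1) (hv : ∑ j ∈ J, v j ^ 2 = 1)
    (hu' : ∑ i, u i ^ 2 = 1) (hv' : ∑ j, v j ^ 2 = 1) {N : ℝ} (hN : 0 < N) :
    ENNReal.ofReal (N * (1 + (lam * (∑ p ∈ I ×ˢ J, g p.1 p.2 * (u p.1 * v p.2)) - 2 * lam ^ 2 -
      (k + q) / 2) - Real.log N)) ≤ smoothedWeight k q lam I J g := by
  have hw : ∀ i, smoothingVar m₁ m₂ k q i ≠ 0 := by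
    rintro (i | j) <;> simp [smoothingVar] <;> lia
  obtain ⟨hint, heq⟩ := integral_shifted_exponent hk hq lam hI hJ g hu hv hu' hv' rfl rfl
  have hF : Measurable fun z => ENNReal.ofReal (expWeight lam I J g z) :=
    ((measurable_expWeight lam I J).comp measurable_prodMk_left).ennreal_ofReal
  rw [smoothedWeight, lintegral_pi_gaussianReal_shift (Sum.elim u v) hw hF, ← heq]
  refine (ofReal_tangent_le_lintegral_exp hint hN).trans_eq (lintegral_congr fun z => ?_)
  rw [← ENNReal.ofReal_mul (Real.exp_pos _).le, expWeight, ← Real.exp_add]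

end GaussianSmoothing

/-! ### Expected maxima of a Gaussian matrix -/

section Maxima

open scoped NNReal ENNReal

variable {m₁ m₂ : ℕ} {S : Type*} [MeasurableSpace S] {P : Measure S}
  {G : S → Matrix (Fin m₁) (Fin m₂) ℝ}

lemma exists_card_eq_support_subset {n k : ℕ} (hk : k ≤ n) {a : EuclideanSpace ℝ (Fin n)}
    (ha : a ∈ sparseUnit n k) : ∃ I : Finset (Fin n), #I = k ∧ ∀ i ∉ I, a i = 0 := by
  classical
  have h : #{i | a i ≠ 0} ≤ k := by
    have := ha.1
    rwa [Set.ncard_eq_toFinset_card', Set.toFinset_ofPred] at this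
  obtain ⟨I, hI, hIk⟩ := exists_superset_card_eq h (by simpa using hk)
  refine ⟨I, hIk, fun i hi => ?_⟩
  by_contra h0
  exact hi (hI (by simpa using h0))

/-- The sum of the smoothed weights over all pairs of supports of sizes `k` and `q`. -/
noncomputable def totalWeight (k q : ℕ) (lam : ℝ) (g : Fin m₁ → Fin m₂ → ℝ) : ℝ≥0∞ :=
  ∑ I ∈ powersetCard k univ, ∑ J ∈ powersetCard q univ, smoothedWeight k q lam I J g

lemma measurable_totalWeight (k q : ℕ) (lam : ℝ) :
    Measurable (totalWeight k q lam : (Fin m₁ → Fin m₂ → ℝ) → ℝ≥0∞) := by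
  have := fun I J => measurable_smoothedWeight (m₁ := m₁) (m₂ := m₂) k q lam I J
  unfold totalWeight
  fun_prop

lemma IsStdGaussianMatrix.lintegral_totalWeight [SFinite P]
    (hG : IsStdGaussianMatrix G P) (k q : ℕ) (lam : ℝ) :
    ∫⁻ s, totalWeight k q lam (fun i j => G s i j) ∂P = m₁.choose k * m₂.choose q := by
  have hm : ∀ I J, AEMeasurable (fun s => smoothedWeight k q lam I J (fun i j => G s i j)) P :=
    fun I J => (measurable_smoothedWeight k q lam I J).comp_aemeasurable hG.aemeasurable
  simp only [totalWeight]
  rw [lintegral_finsetSum' _ fun I _ => Finset.aemeasurable_fun_sum _ fun J _ => hm I J]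
  have h : ∀ I : Finset (Fin m₁), ∫⁻ s, ∑ J ∈ powersetCard q univ,
      smoothedWeight k q lam I J (fun i j => G s i j) ∂P = m₂.choose q := fun I => by
    rw [lintegral_finsetSum' _ fun J _ => hm I J]
    simp [hG.lintegral_smoothedWeight]
  simp [h]

/-- The tangent-line bound: a value of the Gaussian bilinear form at a sparse pair of unit vectors
is dominated by an affine function of the total weight. -/
lemma mul_matInner_le_totalWeight {k q : ℕ} (hk : 1 ≤ k) (hk' : k ≤ m₁) (hq : 1 ≤ q)
    (hq' : q ≤ m₂) (lam : ℝ) {g A : Matrix (Fin m₁) (Fin m₂) ℝ} (hA : A ∈ kqAtoms m₁ m₂ k q)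
    (hg : totalWeight k q lam (fun i j => g i j) ≠ ∞) {N : ℝ} (hN : 0 < N) :
    lam * matInner g A ≤ (totalWeight k q lam (fun i j => g i j)).toReal / N - 1 +
      (2 * lam ^ 2 + (k + q) / 2 + Real.log N) := by
  obtain ⟨a, ha, b, hb, rfl⟩ := hA
  obtain ⟨I, hI, haI⟩ := exists_card_eq_support_subset hk' ha
  obtain ⟨J, hJ, hbJ⟩ := exists_card_eq_support_subset hq' hb
  have hau := sum_sq_eq_one_of_norm ha.2
  have hbu := sum_sq_eq_one_of_norm hb.2
  have haI' : ∑ i ∈ I, a i ^ 2 = 1 :=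
    (sum_subset (subset_univ I) fun i _ hi => by simp [haI i hi]).trans hau
  have hbJ' : ∑ j ∈ J, b j ^ 2 = 1 :=
    (sum_subset (subset_univ J) fun j _ hj => by simp [hbJ j hj]).trans hbu
  have h1 := ofReal_le_smoothedWeight hk hq lam hI hJ (fun i j => g i j) haI' hbJ' hau hbu hN
  have h2 : smoothedWeight k q lam I J (fun i j => g i j) ≤
      totalWeight k q lam (fun i j => g i j) :=
    (single_le_sum (f := fun J => smoothedWeight k q lam I J (fun i j => g i j))
      (fun _ _ => zero_le) (mem_powersetCard_univ.2 hJ)).trans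
      (single_le_sum (f := fun I => ∑ J ∈ powersetCard q univ,
        smoothedWeight k q lam I J (fun i j => g i j))
      (fun _ _ => zero_le) (mem_powersetCard_univ.2 hI))
  have h3 := (ENNReal.ofReal_le_iff_le_toReal hg).1 (h1.trans h2)
  have h4 : ∑ p ∈ I ×ˢ J, g p.1 p.2 * (a p.1 * b p.2) =
      matInner g (Matrix.of fun i j => a i * b j) := by
    rw [matInner_eq_sum, sum_product]
    simp only [Matrix.of_apply]
    refine (sum_congr rfl fun i _ => ?_).trans
      (sum_subset (subset_univ I) fun i _ hi => by simp [haI i hi])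
    exact sum_subset (subset_univ J) fun j _ hj => by simp [hbJ j hj]
  rw [h4, mul_comm, ← le_div_iff₀ hN] at h3
  linarith

lemma integrable_affine_div [IsProbabilityMeasure P] {W : S → ℝ} (hW : Integrable W P)
    (a b c : ℝ) : Integrable (fun s => (W s / a - 1 + b) / c) P ∧
      ∫ s, (W s / a - 1 + b) / c ∂P = ((∫ s, W s ∂P) / a - 1 + b) / c := by
  have h1 : Integrable (fun s => W s / a) P := hW.div_const a
  have h2 : Integrable (fun s => W s / a - 1) P := h1.sub (integrable_const 1)
  refine ⟨(h2.add (integrable_const b)).div_const c, ?_⟩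
  rw [integral_div, integral_add h2 (integrable_const b), integral_sub h1 (integrable_const 1),
    integral_div]
  simp

/-- The supremum of a Gaussian matrix over the atoms `a bᵀ` has mean at most
`2 √(k + q + 2 log N)`, where `N` is the number of pairs of supports. -/
theorem IsStdGaussianMatrix.exists_integrable_bound_kqAtoms [IsProbabilityMeasure P]
    (hG : IsStdGaussianMatrix G P) {k q : ℕ} (hk : 1 ≤ k) (hk' : k ≤ m₁) (hq : 1 ≤ q)
    (hq' : q ≤ m₂) :
    ∃ R : S → ℝ, Integrable R P ∧
      ∫ s, R s ∂P ≤ 2 * √(k + q + 2 * Real.log (m₁.choose k * m₂.choose q)) ∧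
      ∀ᵐ s ∂P, ∀ A ∈ kqAtoms m₁ m₂ k q, matInner (G s) A ≤ R s := by
  set N : ℝ := m₁.choose k * m₂.choose q with hN
  have hN1 : 1 ≤ N := by
    have h1 : 1 ≤ m₁.choose k * m₂.choose q :=
      Nat.mul_pos (Nat.choose_pos hk') (Nat.choose_pos hq')
    rw [hN]
    exact_mod_cast h1
  have hN0 : 0 < N := zero_lt_one.trans_le hN1
  have hlog : 0 ≤ Real.log N := Real.log_nonneg hN1
  set B : ℝ := k + q + 2 * Real.log N with hB
  have hB0 : 0 < B := by positivity
  -- the minimizer of `2 * lam + B / (2 * lam)`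
  set lam : ℝ := √B / 2 with hlam
  have hlam0 : 0 < lam := by positivity
  have hsq : √B ^ 2 = B := Real.sq_sqrt hB0.le
  have hm : AEMeasurable (fun s => totalWeight k q lam (fun i j => G s i j)) P :=
    (measurable_totalWeight k q lam).comp_aemeasurable hG.aemeasurable
  have htot := hG.lintegral_totalWeight k q lam
  have hfin : ∫⁻ s, totalWeight k q lam (fun i j => G s i j) ∂P ≠ ∞ := by
    rw [htot]; exact ENNReal.mul_ne_top (ENNReal.natCast_ne_top _) (ENNReal.natCast_ne_top _)
  have hae := ae_lt_top' hm hfin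
  have hint := integrable_toReal_of_lintegral_ne_top hm hfin
  refine ⟨fun s => ((totalWeight k q lam (fun i j => G s i j)).toReal / N - 1 +
    (2 * lam ^ 2 + (k + q) / 2 + Real.log N)) / lam, ?_, ?_, ?_⟩
  · exact (integrable_affine_div hint _ _ _).1
  · have e : ∫ s, (totalWeight k q lam (fun i j => G s i j)).toReal ∂P = N := by
      rw [integral_toReal hm hae, htot, hN]
      simp
    rw [(integrable_affine_div hint _ _ _).2, e, div_self hN0.ne', sub_self, zero_add,
      div_le_iff₀ hlam0, hlam]
    nlinarith
  · filter_upwards [hae] with s hs A hA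
    rw [le_div_iff₀ hlam0, mul_comm]
    exact mul_matInner_le_totalWeight hk hk' hq hq' lam hA hs.ne hN0

/-- The largest absolute value of the entries of a Gaussian matrix has mean at most
`√(2 log (2 m₁ m₂))`. -/
theorem IsStdGaussianMatrix.exists_integrable_bound_entries [IsProbabilityMeasure P]
    (hG : IsStdGaussianMatrix G P) (hm : 1 ≤ m₁ * m₂) :
    ∃ R : S → ℝ, Integrable R P ∧ ∫ s, R s ∂P ≤ √(2 * Real.log (2 * (m₁ * m₂))) ∧
      ∀ s i j, |G s i j| ≤ R s := by
  set N : ℝ := 2 * (m₁ * m₂) with hN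
  have hN1 : 1 < N := by
    have : (1 : ℝ) ≤ m₁ * m₂ := by exact_mod_cast hm
    linarith
  have hN0 : 0 < N := zero_lt_one.trans hN1
  set B : ℝ := 2 * Real.log N with hB
  have hB0 : 0 < B := by have := Real.log_pos hN1; positivity
  -- the minimizer of `lam / 2 + B / (2 * lam)`
  set lam : ℝ := √B with hlam
  have hlam0 : 0 < lam := by positivity
  have hsq : lam ^ 2 = B := Real.sq_sqrt hB0.le
  have hmgf : ∀ (t : ℝ) i j, ∫ s, Real.exp (t * G s i j) ∂P = Real.exp (t ^ 2 / 2) := by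
    intro t i j
    have := mgf_gaussianReal (hG.1 i j).map_eq t
    simpa [mgf] using this
  have hint : ∀ (t : ℝ) i j, Integrable (fun s => Real.exp (t * G s i j)) P := by
    intro t i j
    by_contra h
    have := hmgf t i j
    rw [integral_undef h] at this
    exact (Real.exp_pos _).ne this
  set W : S → ℝ := fun s => ∑ i, ∑ j, (Real.exp (lam * G s i j) + Real.exp (-lam * G s i j))
  have hWi : ∀ i j, Integrable (fun s =>
      Real.exp (lam * G s i j) + Real.exp (-lam * G s i j)) P := fun i j =>
    (hint lam i j).add (hint (-lam) i j)
  have hW : Integrable W P := integrable_finsetSum _ fun i _ => integrable_finsetSum _ fun j _ =>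
    hWi i j
  have hWint : ∫ s, W s ∂P = N * Real.exp (lam ^ 2 / 2) := by
    simp only [W]
    rw [integral_finsetSum _ fun i _ => integrable_finsetSum _ fun j _ => hWi i j]
    have : ∀ i, ∫ s, ∑ j, (Real.exp (lam * G s i j) + Real.exp (-lam * G s i j)) ∂P =
        m₂ * (2 * Real.exp (lam ^ 2 / 2)) := by
      intro i
      rw [integral_finsetSum _ fun j _ => hWi i j]
      simp only [integral_add (hint lam i _) (hint (-lam) i _), hmgf, neg_sq]
      simp; ring
    simp only [this]
    simp [hN]; ring
  refine ⟨fun s => (W s / (N * Real.exp (lam ^ 2 / 2)) - 1 + (lam ^ 2 / 2 + Real.log N)) / lam,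
    ?_, ?_, ?_⟩
  · exact (integrable_affine_div hW _ _ _).1
  · rw [(integrable_affine_div hW _ _ _).2, hWint, div_self (by positivity), sub_self, zero_add,
      div_le_iff₀ hlam0]
    nlinarith
  · intro s i j
    rw [le_div_iff₀ hlam0]
    have h1 : Real.exp (lam * |G s i j|) ≤ W s := by
      have h2 : Real.exp (lam * |G s i j|) ≤
          Real.exp (lam * G s i j) + Real.exp (-lam * G s i j) := by
        have p1 := Real.exp_pos (lam * G s i j)
        have p2 := Real.exp_pos (-lam * G s i j)
        rcases abs_choice (G s i j) with h | h <;> rw [h]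
        · linarith
        · rw [mul_neg, ← neg_mul]; linarith
      have h3 : ∀ i j, 0 ≤ Real.exp (lam * G s i j) + Real.exp (-lam * G s i j) :=
        fun i j => by positivity
      exact h2.trans ((single_le_sum (f := fun j => Real.exp (lam * G s i j) +
        Real.exp (-lam * G s i j)) (fun j _ => h3 i j) (mem_univ j)).trans
        (single_le_sum (f := fun i => ∑ j, (Real.exp (lam * G s i j) +
          Real.exp (-lam * G s i j))) (fun i _ => sum_nonneg fun j _ => h3 i j) (mem_univ i)))
    -- the tangent line of `exp` at `log (N * exp (lam ^ 2 / 2))`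
    have h4 := Real.add_one_le_exp (lam * |G s i j| - (lam ^ 2 / 2 + Real.log N))
    rw [Real.exp_sub, Real.exp_add, Real.exp_log hN0, mul_comm (Real.exp (lam ^ 2 / 2))] at h4
    have h5 := div_le_div_of_nonneg_right h1 (c := N * Real.exp (lam ^ 2 / 2)) (by positivity)
    linarith

end Maxima

/-! ### Expected error of oracle denoisers -/

section OracleError

variable {m₁ m₂ : ℕ} {S : Type*} [MeasurableSpace S] {P : Measure S}
  {G : S → Matrix (Fin m₁) (Fin m₂) ℝ}

/-- A real function that depends on a random variable `g` in a Lipschitz way, outside a null set,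
is measurable, since it extends to a Lipschitz function of `g`. -/
lemma aemeasurable_of_dist_le {E : Type*} [PseudoMetricSpace E] [MeasurableSpace E]
    [BorelSpace E] {g : S → E} (hg : AEMeasurable g P) {f : S → ℝ} {A : Set S} (hA : A ∈ ae P)
    {K : ℝ} (hf : ∀ s ∈ A, ∀ t ∈ A, |f s - f t| ≤ K * dist (g s) (g t)) : AEMeasurable f P := by
  classical
  let f' : E → ℝ := fun x => if h : ∃ s ∈ A, g s = x then f h.choose else 0
  have hval : ∀ s ∈ A, f' (g s) = f s := by
    intro s hs
    have h : ∃ t ∈ A, g t = g s := ⟨s, hs, rfl⟩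
    have h1 := hf _ h.choose_spec.1 s hs
    rw [h.choose_spec.2, dist_self, mul_zero] at h1
    simp only [f', dif_pos h]
    exact sub_eq_zero.1 (abs_nonpos_iff.1 h1)
  have hlip : LipschitzOnWith K.toNNReal f' (g '' A) := by
    refine LipschitzOnWith.of_dist_le_mul ?_
    rintro _ ⟨s, hs, rfl⟩ _ ⟨t, ht, rfl⟩
    rw [hval s hs, hval t ht, Real.dist_eq]
    exact (hf s hs t ht).trans (mul_le_mul_of_nonneg_right (Real.le_coe_toNNReal K) dist_nonneg)
  obtain ⟨F, hF, hFf⟩ := hlip.extend_real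
  refine (hF.continuous.measurable.comp_aemeasurable hg).congr ?_
  filter_upwards [hA] with s hs
  rw [Function.comp_apply, ← hFf ⟨s, hs, rfl⟩, hval s hs]

lemma l1Norm_sub_le_dist (A B : Matrix (Fin m₁) (Fin m₂) ℝ) :
    l1Norm (A - B) ≤ m₁ * m₂ *
      dist (fun i j => A i j : Fin m₁ → Fin m₂ → ℝ) (fun i j => B i j) := by
  have h : ∀ i j, |(A - B) i j| ≤
      dist (fun i j => A i j : Fin m₁ → Fin m₂ → ℝ) (fun i j => B i j) := fun i j =>
    (dist_le_pi_dist (fun j => A i j) (fun j => B i j) j).trans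
      (dist_le_pi_dist (fun i j => A i j : Fin m₁ → Fin m₂ → ℝ) (fun i j => B i j) i)
  refine (sum_le_sum fun i _ => sum_le_sum fun j _ => h i j).trans_eq ?_
  simp; ring

lemma IsStdGaussianMatrix.integrable_entry (hG : IsStdGaussianMatrix G P) (i : Fin m₁)
    (j : Fin m₂) : Integrable (fun s => G s i j) P := by
  have h : Integrable id (P.map fun s => G s i j) := by
    rw [(hG.1 i j).map_eq]
    exact (memLp_id_gaussianReal 1).integrable (by simp)
  exact (integrable_map_measure h.aestronglyMeasurable (hG.1 i j).aemeasurable).1 h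

lemma IsStdGaussianMatrix.integral_entry (hG : IsStdGaussianMatrix G P) (i : Fin m₁)
    (j : Fin m₂) : ∫ s, G s i j ∂P = 0 :=
  (hG.1 i j).integral_eq.trans integral_id_gaussianReal

lemma IsStdGaussianMatrix.integrable_matInner (hG : IsStdGaussianMatrix G P)
    (Z : Matrix (Fin m₁) (Fin m₂) ℝ) : Integrable (fun s => matInner (G s) Z) P := by
  simp only [matInner_eq_sum]
  exact integrable_finsetSum _ fun i _ => integrable_finsetSum _ fun j _ =>
    (hG.integrable_entry i j).mul_const _

lemma IsStdGaussianMatrix.integral_matInner (hG : IsStdGaussianMatrix G P)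
    (Z : Matrix (Fin m₁) (Fin m₂) ℝ) : ∫ s, matInner (G s) Z ∂P = 0 := by
  simp only [matInner_eq_sum]
  have h : ∀ i j, Integrable (fun s => G s i j * Z i j) P := fun i j =>
    (hG.integrable_entry i j).mul_const _
  rw [integral_finsetSum _ fun i _ => integrable_finsetSum _ fun j _ => h i j]
  refine sum_eq_zero fun i _ => ?_
  rw [integral_finsetSum _ fun j _ => h i j]
  refine sum_eq_zero fun j _ => ?_
  rw [integral_mul_const, hG.integral_entry, zero_mul]

/-- The expected error of an oracle denoiser. The term `⟨G, Zstar⟩` of the deterministic bound is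
centred, which saves a factor of two. -/
theorem IsStdGaussianMatrix.oracle_error_le (hG : IsStdGaussianMatrix G P)
    {Ω : Seminorm ℝ (Matrix (Fin m₁) (Fin m₂) ℝ)} (hΩ : DominatesFunctionals Ω) {σ : ℝ}
    (hσ : 0 < σ) {Zstar : Matrix (Fin m₁) (Fin m₂) ℝ} {R : S → ℝ} (hR : Integrable R P)
    (hGR : ∀ᵐ s ∂P, dualNorm Ω (G s) ≤ R s) {Zhat : S → Matrix (Fin m₁) (Fin m₂) ℝ}
    (hZ : ∀ᵐ s ∂P, IsOracleDenoiser Ω σ Zstar (G s) (Zhat s)) :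
    Integrable (fun s => frobSq (Zhat s - Zstar)) P ∧
      ∫ s, frobSq (Zhat s - Zstar) ∂P ≤ σ * (∫ s, R s ∂P) * Ω Zstar := by
  obtain ⟨K, hK0, hK⟩ := exists_l1Norm_sub_le_of_isOracleDenoiser hσ hΩ Zstar
  have hmeas : ∀ i j, AEMeasurable (fun s => Zhat s i j) P := fun i j => by
    refine aemeasurable_of_dist_le hG.aemeasurable hZ (K := K * (m₁ * m₂)) fun s hs t ht => ?_
    calc |Zhat s i j - Zhat t i j| ≤ l1Norm (Zhat s - Zhat t) :=
          abs_le_l1Norm (Zhat s - Zhat t) i j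
      _ ≤ K * l1Norm (G s - G t) := hK _ _ _ _ hs ht
      _ ≤ K * (m₁ * m₂ * _) := mul_le_mul_of_nonneg_left (l1Norm_sub_le_dist _ _) hK0
      _ = _ := (mul_assoc _ _ _).symm
  have hfrob : AEMeasurable (fun s => frobSq (Zhat s - Zstar)) P := by
    simp only [frobSq, Matrix.sub_apply]
    fun_prop
  set U : S → ℝ := fun s => σ * R s * Ω Zstar - σ * matInner (G s) Zstar
  have hU1 : Integrable (fun s => σ * R s * Ω Zstar) P := (hR.const_mul σ).mul_const _
  have hU2 : Integrable (fun s => σ * matInner (G s) Zstar) P :=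
    (hG.integrable_matInner Zstar).const_mul σ
  have hU : Integrable U P := hU1.sub hU2
  have hle : ∀ᵐ s ∂P, frobSq (Zhat s - Zstar) ≤ U s := by
    filter_upwards [hZ, hGR] with s hs hsR
    refine (IsDenoiser.frobSq_sub_le hσ hΩ le_rfl hs).trans ?_
    have := mul_le_mul_of_nonneg_right (mul_le_mul_of_nonneg_left hsR hσ.le)
      (apply_nonneg Ω Zstar)
    simp only [U]
    linarith
  have hint : Integrable (fun s => frobSq (Zhat s - Zstar)) P := by
    refine hU.mono' hfrob.aestronglyMeasurable ?_
    filter_upwards [hle] with s hs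
    rwa [Real.norm_of_nonneg (frobSq_nonneg _)]
  refine ⟨hint, (integral_mono_ae hint hU hle).trans_eq ?_⟩
  simp only [U]
  rw [integral_sub hU1 hU2, integral_mul_const, integral_const_mul, integral_const_mul,
    hG.integral_matInner]
  ring

/-- The expected error of the oracle denoiser for the `(k,q)`-trace norm at an atom. -/
theorem IsStdGaussianMatrix.kq_oracle_error_le [IsProbabilityMeasure P]
    (hG : IsStdGaussianMatrix G P) {k q : ℕ} (hk : 1 ≤ k) (hk' : k ≤ m₁) (hq : 1 ≤ q)
    (hq' : q ≤ m₂) {σ : ℝ} (hσ : 0 < σ) {Zstar : Matrix (Fin m₁) (Fin m₂) ℝ}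
    (hZstar : Zstar ∈ kqAtoms m₁ m₂ k q) {Zhat : S → Matrix (Fin m₁) (Fin m₂) ℝ}
    (hZ : ∀ᵐ s ∂P, IsOracleDenoiser (kqTraceNorm k q) σ Zstar (G s) (Zhat s)) :
    Integrable (fun s => frobSq (Zhat s - Zstar)) P ∧ ∫ s, frobSq (Zhat s - Zstar) ∂P ≤
      σ * (2 * √(k + q + 2 * Real.log (m₁.choose k * m₂.choose q))) := by
  have hm₁ := hk.trans hk'
  have hm₂ := hq.trans hq'
  obtain ⟨R, hR, hRint, hRG⟩ := hG.exists_integrable_bound_kqAtoms hk hk' hq hq'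
  have hGR : ∀ᵐ s ∂P, dualNorm (kqSeminorm hk hq hm₁ hm₂) (G s) ≤ R s := by
    filter_upwards [hRG] with s hs
    have h0 : 0 ≤ R s := by
      have h1 := hs _ hZstar
      have h2 := hs _ (neg_mem_kqAtoms hZstar)
      rw [matInner_neg_right] at h2
      linarith
    exact dualNorm_le h0 (matInner_le_mul_kqTraceNorm hk hq hm₁ hm₂ h0 hs)
  obtain ⟨h1, h2⟩ := hG.oracle_error_le (dominatesFunctionals_kqSeminorm hk hq hm₁ hm₂) hσ hR hGR hZ
  refine ⟨h1, h2.trans ?_⟩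
  have h3 : kqSeminorm hk hq hm₁ hm₂ Zstar ≤ 1 := kqTraceNorm_le_one_of_mem hZstar
  have h4 : 0 ≤ 2 * √(k + q + 2 * Real.log (m₁.choose k * m₂.choose q)) := by positivity
  calc σ * (∫ s, R s ∂P) * kqSeminorm hk hq hm₁ hm₂ Zstar
      ≤ σ * (2 * √(k + q + 2 * Real.log (m₁.choose k * m₂.choose q))) *
        kqSeminorm hk hq hm₁ hm₂ Zstar :=
        mul_le_mul_of_nonneg_right (mul_le_mul_of_nonneg_left hRint hσ.le) (apply_nonneg _ _)
    _ ≤ _ := mul_le_of_le_one_right (mul_nonneg hσ.le h4) h3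

end OracleError

/-! ### Comparison of the numerical bounds -/

section Numerics

lemma log_choose_le {n k : ℕ} (hk : 1 ≤ k) (hkn : k ≤ n) :
    Real.log (n.choose k) ≤ k * Real.log (n / k) + k := by
  have hk0 : (0 : ℝ) < k := by exact_mod_cast hk
  have hn0 : (0 : ℝ) < n := by exact_mod_cast hk.trans hkn
  have hf : (0 : ℝ) < k.factorial := by exact_mod_cast k.factorial_pos
  have h1 : (n.choose k : ℝ) ≤ (n / k : ℝ) ^ k * Real.exp k := by
    have h2 := Real.pow_div_factorial_le_exp (x := k) hk0.le k
    calc (n.choose k : ℝ) ≤ (n : ℝ) ^ k / k.factorial := Nat.choose_le_pow_div k n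
      _ = (n / k : ℝ) ^ k * ((k : ℝ) ^ k / k.factorial) := by
        rw [div_pow]; field_simp
      _ ≤ _ := mul_le_mul_of_nonneg_left h2 (by positivity)
  have hc : (0 : ℝ) < n.choose k := by exact_mod_cast Nat.choose_pos hkn
  refine (Real.log_le_log hc h1).trans_eq ?_
  rw [Real.log_mul (by positivity) (Real.exp_pos _).ne', Real.log_exp, Real.log_pow]

lemma sqrt_add_log_choose_le {m₁ m₂ k q : ℕ} (hk : 1 ≤ k) (hk' : k ≤ m₁) (hq : 1 ≤ q)
    (hq' : q ≤ m₂) :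
    2 * √(k + q + 2 * Real.log (m₁.choose k * m₂.choose q)) ≤
      8 * (√(k * Real.log (m₁ / k) + 2 * k) + √(q * Real.log (m₂ / q) + 2 * q)) := by
  have hpos : ∀ {n j : ℕ}, 1 ≤ j → j ≤ n → 0 ≤ (j : ℝ) * Real.log (n / j) := by
    intro n j hj hjn
    have hj0 : (0 : ℝ) < j := by exact_mod_cast hj
    refine mul_nonneg hj0.le (Real.log_nonneg ?_)
    rw [one_le_div hj0]
    exact_mod_cast hjn
  have e1 := hpos hk hk'
  have e2 := hpos hq hq'
  have l1 := log_choose_le hk hk'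
  have l2 := log_choose_le hq hq'
  have hlog : Real.log (m₁.choose k * m₂.choose q) =
      Real.log (m₁.choose k) + Real.log (m₂.choose q) :=
    Real.log_mul (by exact_mod_cast (Nat.choose_pos hk').ne')
      (by exact_mod_cast (Nat.choose_pos hq').ne')
  set a : ℝ := k * Real.log (m₁ / k) + 2 * k
  set b : ℝ := q * Real.log (m₂ / q) + 2 * q
  have ha : 0 ≤ a := by positivity
  have hb : 0 ≤ b := by positivity
  have hkR : (0 : ℝ) ≤ k := k.cast_nonneg
  have hqR : (0 : ℝ) ≤ q := q.cast_nonneg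
  have h : √(k + q + 2 * Real.log (m₁.choose k * m₂.choose q)) ≤ 4 * (√a + √b) := by
    refine Real.sqrt_le_iff.2 ⟨by positivity, ?_⟩
    have ha2 := Real.sq_sqrt ha
    have hb2 := Real.sq_sqrt hb
    have hab : 0 ≤ √a * √b := by positivity
    have hX : k + q + 2 * Real.log (m₁.choose k * m₂.choose q) ≤ 2 * (a + b) := by
      rw [hlog]; simp only [a, b]; linarith
    calc k + q + 2 * Real.log (m₁.choose k * m₂.choose q) ≤ 2 * (a + b) := hX
      _ ≤ (4 * (√a + √b)) ^ 2 := by nlinarith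
  linarith

lemma sqrt_two_mul_log_two_mul_le {x : ℝ} (hx : 2 ≤ x) :
    √(2 * Real.log (2 * x)) ≤ 2 * √(2 * Real.log x) := by
  have h1 : Real.log (2 * x) ≤ 4 * Real.log x := by
    have h2 : Real.log 2 ≤ Real.log x := Real.log_le_log two_pos hx
    have h3 : 0 ≤ Real.log x := Real.log_nonneg (by linarith)
    rw [Real.log_mul two_ne_zero (by linarith)]
    linarith
  have h4 : (2 : ℝ) * √(2 * Real.log x) = √(4 * (2 * Real.log x)) := by
    rw [Real.sqrt_mul (by norm_num) (2 * Real.log x), show (4 : ℝ) = 2 ^ 2 by norm_num,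
      Real.sqrt_sq two_pos.le]
  rw [h4]
  exact Real.sqrt_le_sqrt (by linarith)

/-- The `ℓ₁` norm of a unit vector with at most `j` nonzero coordinates is at most `√j`. -/
lemma sum_abs_le_sqrt_of_mem_sparseUnit {n j : ℕ} {a : EuclideanSpace ℝ (Fin n)}
    (ha : a ∈ sparseUnit n j) : ∑ i, |a i| ≤ √j := by
  classical
  refine Real.le_sqrt_of_sq_le ?_
  have hcard : #{i | a i ≠ 0} ≤ j := by
    have := ha.1
    rwa [Set.ncard_eq_toFinset_card', Set.toFinset_ofPred] at this
  have h1 : ∑ i ∈ {i | a i ≠ 0}, |a i| = ∑ i, |a i| :=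
    sum_subset (subset_univ _) fun i _ hi => by simpa using hi
  have h2 : ∑ i ∈ {i | a i ≠ 0}, |a i| ^ 2 = 1 := by
    simp only [sq_abs]
    exact (sum_subset (subset_univ _) fun i _ hi => by simpa using hi).trans
      (sum_sq_eq_one_of_norm ha.2)
  rw [← h1]
  refine sq_sum_le_card_mul_sum_sq.trans ?_
  rw [h2, mul_one]
  exact_mod_cast hcard

lemma l1Norm_le_of_mem_kqAtoms {m₁ m₂ k q : ℕ} {A : Matrix (Fin m₁) (Fin m₂) ℝ}
    (hA : A ∈ kqAtoms m₁ m₂ k q) : l1Norm A ≤ √(k * q) := by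
  obtain ⟨a, ha, b, hb, rfl⟩ := hA
  have : l1Norm (Matrix.of fun i j => a i * b j) = (∑ i, |a i|) * ∑ j, |b j| := by
    simp only [l1Norm, Matrix.of_apply, abs_mul, sum_mul_sum]
  rw [this, Real.sqrt_mul (Nat.cast_nonneg k)]
  exact mul_le_mul (sum_abs_le_sqrt_of_mem_sparseUnit ha) (sum_abs_le_sqrt_of_mem_sparseUnit hb)
    (sum_nonneg fun _ _ => abs_nonneg _) (Real.sqrt_nonneg _)

end Numerics

end

/-! ### The error bounds for the three denoisers -/

theorem mainTheorem5 {m₁ m₂ : ℕ} (σ : ℝ) (hσ : 0 < σ) :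
    -- general slow-rate inequality, for an arbitrary norm `Ω`
    (∀ Ω : Seminorm ℝ (Matrix (Fin m₁) (Fin m₂) ℝ), (∀ Z, Ω Z = 0 → Z = 0) →
      ∀ (Zstar G Zhat : Matrix (Fin m₁) (Fin m₂) ℝ) (lam : ℝ),
        σ * dualNorm Ω G ≤ lam →
        IsDenoiser Ω lam (Zstar + σ • G) Zhat →
        frobSq (Zhat - Zstar) ≤ 4 * lam * Ω Zstar) ∧
    -- expected errors of the three oracle denoisers at an atom
    (∀ k q : ℕ, 1 ≤ k → k ≤ m₁ → 1 ≤ q → q ≤ m₂ →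
      ∀ Zstar ∈ kqAtoms m₁ m₂ k q,
      ∀ {S : Type*} [MeasurableSpace S] (P : MeasureTheory.Measure S)
        [MeasureTheory.IsProbabilityMeasure P]
        (G : S → Matrix (Fin m₁) (Fin m₂) ℝ), IsStdGaussianMatrix G P →
      ∀ Zhat : S → Matrix (Fin m₁) (Fin m₂) ℝ,
        ((∀ᵐ s ∂P, IsOracleDenoiser (kqTraceNorm k q) σ Zstar (G s) (Zhat s)) →
          MeasureTheory.Integrable (fun s => frobSq (Zhat s - Zstar)) P ∧
          ∫ s, frobSq (Zhat s - Zstar) ∂P ≤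
            8 * σ * (√(k * Real.log (m₁ / k) + 2 * k) + √(q * Real.log (m₂ / q) + 2 * q))) ∧
        (2 ≤ m₁ * m₂ →
          (∀ᵐ s ∂P, IsOracleDenoiser l1Norm σ Zstar (G s) (Zhat s)) →
          MeasureTheory.Integrable (fun s => frobSq (Zhat s - Zstar)) P ∧
          ∫ s, frobSq (Zhat s - Zstar) ∂P ≤
            2 * σ * l1Norm Zstar * √(2 * Real.log (m₁ * m₂)) ∧
          2 * σ * l1Norm Zstar * √(2 * Real.log (m₁ * m₂)) ≤
            2 * σ * √(2 * k * q * Real.log (m₁ * m₂))) ∧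
        ((∀ᵐ s ∂P, IsOracleDenoiser traceNorm σ Zstar (G s) (Zhat s)) →
          MeasureTheory.Integrable (fun s => frobSq (Zhat s - Zstar)) P ∧
          ∫ s, frobSq (Zhat s - Zstar) ∂P ≤ 2 * σ * (√m₁ + √m₂))) := by
  refine ⟨fun Ω hΩ Zstar G Zhat lam hlam h => ?_, ?_⟩
  · have hdom := dominatesFunctionals_of_definite hΩ
    have h1 := h.frobSq_sub_le hσ hdom hlam
    have h2 : -matInner G Zstar ≤ dualNorm Ω G * Ω Zstar := by
      have := matInner_le_dualNorm_mul hdom G (-Zstar)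
      rwa [matInner_neg_right, map_neg_eq_map] at this
    have h3 := mul_le_mul_of_nonneg_left h2 hσ.le
    have h4 := mul_le_mul_of_nonneg_right hlam (apply_nonneg Ω Zstar)
    have h5 : 0 ≤ lam * Ω Zstar :=
      mul_nonneg ((mul_nonneg hσ.le (dualNorm_nonneg hdom G)).trans hlam) (apply_nonneg _ _)
    linarith
  · intro k q hk hk' hq hq' Zstar hZstar S _ P _ G hG Zhat
    refine ⟨fun hZ => ?_, fun hm hZ => ?_, fun hZ => ?_⟩
    · obtain ⟨h1, h2⟩ := hG.kq_oracle_error_le hk hk' hq hq' hσ hZstar hZ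
      refine ⟨h1, h2.trans ?_⟩
      have := mul_le_mul_of_nonneg_left (sqrt_add_log_choose_le hk hk' hq hq') hσ.le
      linarith
    · have hmR : (2 : ℝ) ≤ m₁ * m₂ := by exact_mod_cast hm
      obtain ⟨R, hR, hRint, hRG⟩ := hG.exists_integrable_bound_entries (by lia)
      have hGR : ∀ᵐ s ∂P, dualNorm (l1Seminorm m₁ m₂) (G s) ≤ R s :=
        .of_forall fun s => dualNorm_le
          ((abs_nonneg _).trans (hRG s ⟨0, hk.trans hk'⟩ ⟨0, hq.trans hq'⟩))
          fun _ => matInner_le_mul_l1Norm (hRG s)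
      obtain ⟨h1, h2⟩ := hG.oracle_error_le dominatesFunctionals_l1Seminorm hσ hR hGR hZ
      have h3 : l1Seminorm m₁ m₂ Zstar = l1Norm Zstar := rfl
      rw [h3] at h2
      refine ⟨h1, h2.trans ?_, ?_⟩
      · have h4 := hRint.trans (sqrt_two_mul_log_two_mul_le hmR)
        have h5 := mul_le_mul_of_nonneg_right (mul_le_mul_of_nonneg_left h4 hσ.le)
          (l1Norm_nonneg Zstar)
        linarith
      · have h4 : (2 * k * q * Real.log (m₁ * m₂) : ℝ) = k * q * (2 * Real.log (m₁ * m₂)) := by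
          ring
        rw [h4, Real.sqrt_mul (by positivity : (0 : ℝ) ≤ k * q), mul_assoc (2 * σ)]
        exact mul_le_mul_of_nonneg_left (mul_le_mul_of_nonneg_right
          (l1Norm_le_of_mem_kqAtoms hZstar) (Real.sqrt_nonneg _)) (by positivity)
    · have hm₁ := hk.trans hk'
      have hm₂ := hq.trans hq'
      have hZ' : ∀ᵐ s ∂P, IsOracleDenoiser (kqTraceNorm m₁ m₂) σ Zstar (G s) (Zhat s) := by
        rwa [← funext (traceNorm_eq_kqTraceNorm hm₁ hm₂)]
      have hZstar' : Zstar ∈ kqAtoms m₁ m₂ m₁ m₂ := by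
        obtain ⟨a, ha, b, hb, rfl⟩ := hZstar
        exact ⟨a, mem_sparseUnit_self_iff.2 ha.2, b, mem_sparseUnit_self_iff.2 hb.2, rfl⟩
      obtain ⟨h1, h2⟩ := hG.kq_oracle_error_le hm₁ le_rfl hm₂ le_rfl hσ hZstar' hZ'
      refine ⟨h1, h2.trans ?_⟩
      have h3 : √(m₁ + m₂ + 2 * Real.log (m₁.choose m₁ * m₂.choose m₂)) ≤ √m₁ + √m₂ := by
        rw [Nat.choose_self, Nat.choose_self]
        simp only [Nat.cast_one, mul_one, Real.log_one, mul_zero, add_zero]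
        refine Real.sqrt_le_iff.2 ⟨by positivity, ?_⟩
        have e1 := Real.sq_sqrt (Nat.cast_nonneg (α := ℝ) m₁)
        have e2 := Real.sq_sqrt (Nat.cast_nonneg (α := ℝ) m₂)
        have e3 : 0 ≤ √(m₁ : ℝ) * √(m₂ : ℝ) := by positivity
        linarith [add_sq (√(m₁ : ℝ)) (√(m₂ : ℝ))]
      have := mul_le_mul_of_nonneg_left h3 hσ.le
      linarith
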